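/- Let $N\ge 1$, $\lambda_r,\lambda_p>0$, and consider a system of $N$ agents labelled $1,\dots,N$ on a probability space, as follows (Ping model). \emph{Clocks and values.} Each label $i$ carries a Poisson clock of rate $\lambda_r$ (its replacement times) and a Poisson clock of rate $\lambda_p$ (its Ping times). The initial agents and every newly arriving agent are attributed i.i.d. values with mean $0$ and variance $\sigma^2<\infty$. The replacement clocks are independent of each other and of the values. The Ping clocks are (jointly) independent of the replacements and of the values, but the Ping clocks of different agents may depend on each other in an arbitrary way. Let $x_i(t)$ be the value of the agent occupying label $i$ at time $t$, and $\bar x(t)=\frac1N\sum_{i=1}^N x_i(t)$. \emph{Knowledge sets.} The knowledge set $K_i(t)$ of agent $i$ starts as $K_i(0)=\{(x_i(0),i,0)\}$ and changes only as follows. At a Ping time $\tau$ of $i$, the agent receives information from all other agents: $$K_i(\tau^+)=K_i(\tau^-)\cup\bigcup_{j\ne i}\Big(K_j(\tau^-)\cup\{(x_j(\tau),j,\tau)\}\cup\{(j\to i,\tau)\}\Big).$$ At a replacement time $\tau$ of $i$, the new agent, with value $x_i'$, inherits the memory of the one it replaces: $K_i(\tau^+)=K_i(\tau^-)\cup\{(x_i',i,\tau)\}$.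 \emph{Algorithms.} An algorithm that can be implemented on these knowledge sets produces at each time $t$ an estimate $y_i(t)=g_{i,t}(K_i(t))$ of $\bar x(t)$ for each agent $i$, where $g_{i,t}$ is an arbitrary measurable function (for the usual counting $\sigma$-algebra on sets of items of information). The functions $g_{i,t}$ may depend on $N$, $\lambda_r$, $\lambda_p$ and on the joint distribution of values, replacements and Ping updates. Let $C(t)=\frac1N\sum_{i=1}^N(\bar x(t)-y_i(t))^2$. \textbf{Theorem.} For any such algorithm and every $t\ge 0$ (the expectation being possibly $+\infty$), $$\mathbb E[C(t)]\;\ge\;\frac{N-1}{N^2}\left(\frac{1}{1+\frac12\frac{\lambda_p}{\lambda_r}}+\frac{e^{-(\lambda_p+2\lambda_r)t}}{1+2\frac{\lambda_r}{\lambda_p}}\right)\sigma^2 .$$ -/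

import Mathlib

open MeasureTheory ProbabilityTheory

noncomputable section

/-- The counting sigma-algebra on sets of points of `α`: the smallest one for which the number of
points in `B` is measurable, for every measurable `B`. It is the usual sigma-algebra for random
(finite or locally finite) sets. -/
@[reducible] def countingSigma (α : Type*) [MeasurableSpace α] : MeasurableSpace (Set α) :=
  ⨆ B : {B : Set α // MeasurableSet B},
    MeasurableSpace.comap (fun K : Set α => (K ∩ B.1).encard) ⊤

/-- The sigma-algebra on `Ω` generated by a random set of times. -/
@[reducible] def timesSigma {Ω : Type*} (T : Ω → Set ℝ) : MeasurableSpace Ω :=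
  (countingSigma ℝ).comap T

/-- A random set of times is a (homogeneous) Poisson clock of the given rate: it is a locally finite
random subset of `(0, ∞)` whose increments are independent and Poisson distributed. -/
structure IsPoissonClock {Ω : Type*} [MeasurableSpace Ω] (μ : Measure Ω)
    (T : Ω → Set ℝ) (rate : ℝ) : Prop where
  measurable : Measurable[_, countingSigma ℝ] T
  pos : ∀ ω, T ω ⊆ Set.Ioi 0
  locallyFinite : ∀ ω t, (T ω ∩ Set.Iic t).Finite
  increment_law : ∀ s t : ℝ, 0 ≤ s → s ≤ t →
    μ.map (fun ω => (T ω ∩ Set.Ioc s t).ncard) = poissonMeasure (rate * (t - s)).toNNReal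
  increments_indep : ∀ u : ℕ → ℝ, 0 ≤ u 0 → Monotone u →
    iIndepFun (fun (k : ℕ) ω => (T ω ∩ Set.Ioc (u k) (u (k + 1))).ncard) μ

/-- A piece of information: either `(v, j, s)`, "the value of agent `j` at time `s` is `v`", or
`(j → i, s)`, "the information exchange from `j` to `i` happened at time `s`". -/
abbrev Info (N : ℕ) : Type := (ℝ × Fin N × ℝ) ⊕ (Fin N × Fin N × ℝ)

/-- The information that the value of agent `j` at time `s` is `v`. -/
abbrev Info.value {N : ℕ} (v : ℝ) (j : Fin N) (s : ℝ) : Info N := Sum.inl (v, j, s)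

/-- The information that `j` sent its information to `i` at time `s`. -/
abbrev Info.exchange {N : ℕ} (j i : Fin N) (s : ℝ) : Info N := Sum.inr (j, i, s)

/-- `PingKnows R P x i t a`: along the realisation with replacement times `R`, Ping times `P` and
held values `x`, the item `a` belongs to the knowledge set of agent `i` at time `t` (after the events
occurring at time `t`, if any). Knowledge is never erased, since an arriving agent inherits that of
the agent it replaces. The rule `relay` adds `K_j(s⁻)`, the union of the `K_j(r)` over `r < s`. -/
inductive PingKnows {N : ℕ} (R P : Fin N → Set ℝ) (x : Fin N → ℝ → ℝ) :
    Fin N → ℝ → Info N → Prop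
  | init (i : Fin N) (t : ℝ) (ht : 0 ≤ t) :
      PingKnows R P x i t (Info.value (x i 0) i 0)
  | replacement (i : Fin N) (s t : ℝ) (hs : s ∈ R i) (hst : s ≤ t) :
      PingKnows R P x i t (Info.value (x i s) i s)
  | value (i j : Fin N) (s t : ℝ) (hji : j ≠ i) (hs : s ∈ P i) (hst : s ≤ t) :
      PingKnows R P x i t (Info.value (x j s) j s)
  | exchange (i j : Fin N) (s t : ℝ) (hji : j ≠ i) (hs : s ∈ P i) (hst : s ≤ t) :
      PingKnows R P x i t (Info.exchange j i s)
  | relay (i j : Fin N) (r s t : ℝ) (a : Info N) (hji : j ≠ i) (hs : s ∈ P i) (hst : s ≤ t)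
      (hrs : r < s) (h : PingKnows R P x j r a) :
      PingKnows R P x i t a

/-- The open system with `N` labels under the Ping model. The `k`-th occupant of label `i` (`k = 0`
being the initial one) is attributed the value `attributed i k`. Nothing is assumed on the dependence
between the Ping clocks of the different agents. -/
structure PingModel {Ω : Type*} [MeasurableSpace Ω] (μ : Measure Ω) (N : ℕ)
    (lamR lamP σ : ℝ) where
  replacements : Fin N → Ω → Set ℝ
  pings : Fin N → Ω → Set ℝ
  attributed : Fin N → ℕ → Ω → ℝ
  /-- the common distribution of the attributed values -/
  valueLaw : Measure ℝ
  replacements_clock : ∀ i, IsPoissonClock μ (replacements i) lamR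
  pings_clock : ∀ i, IsPoissonClock μ (pings i) lamP
  attributed_measurable : ∀ i k, Measurable (attributed i k)
  attributed_law : ∀ i k, μ.map (attributed i k) = valueLaw
  valueLaw_memLp : MemLp (fun v : ℝ => v) 2 valueLaw
  valueLaw_mean : ∫ v, v ∂valueLaw = 0
  valueLaw_variance : ∫ v, v ^ 2 ∂valueLaw = σ ^ 2
  attributed_indep : iIndepFun (fun q : Fin N × ℕ => attributed q.1 q.2) μ
  replacements_indep : iIndep (fun i => timesSigma (replacements i)) μ
  /-- the replacements are independent of the values -/
  replacements_indep_values : Indep (⨆ i, timesSigma (replacements i))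
    (⨆ i, ⨆ k, MeasurableSpace.comap (attributed i k) inferInstance) μ
  /-- the Ping updates are independent of the replacements and of the values -/
  pings_indep : Indep (⨆ i, timesSigma (pings i))
    ((⨆ i, timesSigma (replacements i)) ⊔
      (⨆ i, ⨆ k, MeasurableSpace.comap (attributed i k) inferInstance)) μ

namespace PingModel

variable {Ω : Type*} [MeasurableSpace Ω] {μ : Measure Ω} {N : ℕ} {lamR lamP σ : ℝ}

/-- The value `x_i(t)` held by the occupant of label `i` at time `t`. -/
def heldValue (M : PingModel μ N lamR lamP σ) (ω : Ω) (i : Fin N) (t : ℝ) : ℝ :=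
  M.attributed i (M.replacements i ω ∩ Set.Iic t).ncard ω

/-- The average of the values held at time `t`. -/
def average (M : PingModel μ N lamR lamP σ) (t : ℝ) (ω : Ω) : ℝ :=
  (1 / (N : ℝ)) * ∑ i, M.heldValue ω i t

/-- The knowledge set of agent `i` at time `t`. -/
def knowledge (M : PingModel μ N lamR lamP σ) (i : Fin N) (t : ℝ) (ω : Ω) : Set (Info N) :=
  {a | PingKnows (fun j => M.replacements j ω) (fun j => M.pings j ω) (M.heldValue ω) i t a}

end PingModel

/-- An algorithm: the estimate of agent `i` at time `t` is an arbitrary measurable function of the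
knowledge set that `i` has at time `t`. -/
structure Algorithm (N : ℕ) where
  estimate : Fin N → ℝ → Set (Info N) → ℝ
  measurable_estimate : ∀ i t, Measurable[countingSigma (Info N), _] (estimate i t)

/-- The mean squared error `C(t)` of an algorithm run on the knowledge sets of the Ping model. -/
def PingModel.meanSquaredError {Ω : Type*} [MeasurableSpace Ω] {μ : Measure Ω} {N : ℕ}
    {lamR lamP σ : ℝ} (M : PingModel μ N lamR lamP σ) (y : Algorithm N) (t : ℝ) (ω : Ω) : ℝ :=
  (1 / (N : ℝ)) * ∑ i, (M.average t ω - y.estimate i t (M.knowledge i t ω)) ^ 2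

end

/-! Fix an agent `i` and let `s` be such that `i` has no ping in `(s, t]`. What `i` knows at time
`t` is then determined by the Ping clocks, its own label, and the history of the other labels up to
`s`. For `j ≠ i`, the occupant of `j` at time `s` is still there at time `t` with probability `exp
(-lamR * (t - s))`; otherwise the value at `j` is fresh, centred and independent of that
information. So the best prediction of `x_j(t)` is `p * x_j(s)` with `p = exp (-lamR * (t - s))`,
and its error has variance `(1 - p ^ 2) * σ ^ 2`. These errors are orthogonal for different `j`, so
their average over the `N - 1` foreign labels costs `(N - 1) / N ^ 2 * (1 - p ^ 2) * σ ^ 2`. If `i`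
has had no ping at all, the best prediction is `0`, which amounts to `p = 0`.

The age of the last ping is exponential of rate `lamP`, cut off at `t`. Averaging `1 - exp (-2 *
lamR * age)` over it gives the stated constant. The whole family of Ping clocks may be treated as
known, because it is independent of replacements and values; hence the dependence between these
clocks is irrelevant.

No conditional expectation is formed: being the best prediction is expressed as orthogonality to
square integrable functions (`integral_heldValue_mul_of_stoppedSigma`,
`integral_heldValue_mul_of_unseenSigma`). That the estimate is measurable for the reduced
information is `measurable_indicator_estimate_stoppedSigma` and its analogue for `unseenSigma`. The
Hilbert space bound on an event is `le_setLIntegral_of_best_predictions`. The average over the last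
ping is a Riemann sum of mesh `t / n` in `le_lintegral_agent`, followed by `n → ∞`. -/

/-! ### Measurability of random countable sets -/

/-- A random set is measurably enumerated if it consists of the values of a sequence of random
points, each of which is present on a measurable event. -/
def MeasurablyEnumerated {Ω α : Type*} [MeasurableSpace Ω] [MeasurableSpace α]
    (K : Ω → Set α) : Prop :=
  ∃ (E : ℕ → Set Ω) (a : ℕ → Ω → α), (∀ n, MeasurableSet (E n)) ∧ (∀ n, Measurable (a n)) ∧
    ∀ ω b, b ∈ K ω ↔ ∃ n, ω ∈ E n ∧ a n ω = b

namespace MeasurablyEnumerated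

variable {Ω α β : Type*} [MeasurableSpace Ω] [MeasurableSpace α] [MeasurableSpace β]

theorem optional_point {E : Set Ω} (hE : MeasurableSet E) {a : Ω → α} (ha : Measurable a) :
    MeasurablyEnumerated (fun ω => {b | ω ∈ E ∧ a ω = b}) :=
  ⟨fun _ => E, fun _ => a, fun _ => hE, fun _ => ha, fun ω b => by simp⟩

theorem iUnion [Nonempty α] {ι : Type*} [Countable ι] {K : ι → Ω → Set α}
    (hK : ∀ i, MeasurablyEnumerated (K i)) : MeasurablyEnumerated (fun ω => ⋃ i, K i ω) := by
  rcases isEmpty_or_nonempty ι with hι | hι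
  · exact ⟨fun _ => ∅, fun _ _ => Classical.arbitrary α, fun _ => MeasurableSet.empty,
      fun _ => measurable_const, fun ω b => by simp⟩
  choose E a hE ha h using hK
  obtain ⟨f, hf⟩ := exists_surjective_nat ι
  refine ⟨fun n => E (f n.unpair.1) n.unpair.2, fun n => a (f n.unpair.1) n.unpair.2,
    fun n => hE _ _, fun n => ha _ _, fun ω b => ?_⟩
  simp only [Set.mem_iUnion, h]
  constructor
  · rintro ⟨i, n, hn⟩
    obtain ⟨k, rfl⟩ := hf i
    exact ⟨Nat.pair k n, by simpa using hn⟩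
  · rintro ⟨n, hn⟩
    exact ⟨_, _, hn⟩

theorem union [Nonempty α] {K L : Ω → Set α}
    (hK : MeasurablyEnumerated K) (hL : MeasurablyEnumerated L) :
    MeasurablyEnumerated (fun ω => K ω ∪ L ω) := by
  have := iUnion (ι := Bool) (K := fun b => cond b K L) (by rintro (_ | _) <;> assumption)
  convert this using 2 with ω
  ext b
  simp [or_comm]

theorem image_of {K : Ω → Set α} (hK : MeasurablyEnumerated K) {S : Set (Ω × α)}
    (hS : MeasurableSet S) {f : Ω × α → β} (hf : Measurable f) :
    MeasurablyEnumerated (fun ω => {b | ∃ a ∈ K ω, (ω, a) ∈ S ∧ f (ω, a) = b}) := by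
  obtain ⟨E, a, hE, ha, h⟩ := hK
  refine ⟨fun n => E n ∩ (fun ω => (ω, a n ω)) ⁻¹' S, fun n ω => f (ω, a n ω),
    fun n => (hE n).inter ((measurable_id.prodMk (ha n)) hS),
    fun n => hf.comp (measurable_id.prodMk (ha n)), fun ω b => ?_⟩
  simp only [Set.mem_ofPred_eq, h]
  constructor
  · rintro ⟨_, ⟨n, hn, rfl⟩, h1, h2⟩
    exact ⟨n, ⟨hn, h1⟩, h2⟩
  · rintro ⟨n, ⟨hn, h1⟩, h2⟩
    exact ⟨_, ⟨n, hn, rfl⟩, h1, h2⟩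

/-- At least `n` points lie in `B` exactly when some `n` indices give present, pairwise distinct
points of `B`. This is a countable union over finite index sets; distinctness is an event because
equality in `α` is measurable. -/
theorem measurable [MeasurableEq α] {K : Ω → Set α} (hK : MeasurablyEnumerated K) :
    Measurable[_, countingSigma α] K := by
  obtain ⟨E, a, hE, ha, h⟩ := hK
  rw [measurable_iff_comap_le]
  simp only [countingSigma, MeasurableSpace.comap_iSup, MeasurableSpace.comap_comp, iSup_le_iff]
  rintro ⟨B, hB⟩
  rw [← measurable_iff_comap_le]
  have key : ∀ n : ℕ, MeasurableSet {ω | (n : ℕ∞) ≤ (K ω ∩ B).encard} := by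
    intro n
    have : {ω | (n : ℕ∞) ≤ (K ω ∩ B).encard} = ⋃ S : {S : Finset ℕ // S.card = n},
        ((⋂ k ∈ S.1, (E k ∩ a k ⁻¹' B)) ∩
          ⋂ k ∈ S.1, ⋂ l ∈ S.1, {ω | a k ω = a l ω → k = l}) := by
      ext ω
      simp only [Set.mem_ofPred_eq, Set.mem_iUnion, Set.mem_inter_iff, Set.mem_iInter,
        Set.mem_preimage]
      constructor
      · intro hn
        obtain ⟨t, ht, htn⟩ := Set.exists_subset_encard_eq hn
        have htf : t.Finite := Set.finite_of_encard_eq_coe htn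
        have : ∀ b ∈ t, ∃ k, ω ∈ E k ∧ a k ω = b := fun b hb => (h ω b).1 (ht hb).1
        choose! g hg using this
        have hinj : Set.InjOn g t := fun b hb c hc hbc => by
          rw [← (hg b hb).2, ← (hg c hc).2, hbc]
        refine ⟨⟨(htf.image g).toFinset, ?_⟩, ?_, ?_⟩
        · rw [← Set.ncard_eq_toFinset_card _ (htf.image g), hinj.ncard_image]
          rw [Set.ncard, htn]; rfl
        · rintro k hk
          simp only [Set.Finite.mem_toFinset, Set.mem_image] at hk
          obtain ⟨b, hb, rfl⟩ := hk
          refine ⟨(hg b hb).1, ?_⟩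
          rw [(hg b hb).2]; exact (ht hb).2
        · rintro k hk l hl hkl
          simp only [Set.Finite.mem_toFinset, Set.mem_image] at hk hl
          obtain ⟨b, hb, rfl⟩ := hk
          obtain ⟨c, hc, rfl⟩ := hl
          rw [(hg b hb).2, (hg c hc).2] at hkl
          rw [hkl]
      · rintro ⟨⟨S, hS⟩, h1, h2⟩
        have hinj : Set.InjOn (fun k => a k ω) (S : Set ℕ) := fun k hk l hl => h2 k hk l hl
        rw [← hS, ← Set.encard_coe_eq_coe_finsetCard, ← hinj.encard_image]
        apply Set.encard_le_encard
        rintro _ ⟨k, hk, rfl⟩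
        exact ⟨(h ω _).2 ⟨k, (h1 k hk).1, rfl⟩, (h1 k hk).2⟩
    rw [this]
    refine MeasurableSet.iUnion fun S => MeasurableSet.inter ?_ ?_
    · exact S.1.measurableSet_biInter fun k _ => (hE k).inter (ha k hB)
    · refine S.1.measurableSet_biInter fun k _ => S.1.measurableSet_biInter fun l _ => ?_
      by_cases hkl : k = l
      · simp [hkl]
      · simp only [hkl, imp_false]
        exact (measurableSet_eq_fun (ha k) (ha l)).compl
  refine @measurable_to_countable' _ _ ⊤ _ _ _ fun x => ?_
  induction x using ENat.recTopCoe with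
  | top =>
    have : ((fun K : Set α => (K ∩ B).encard) ∘ K) ⁻¹' {⊤} =
        ⋂ n : ℕ, {ω | (n : ℕ∞) ≤ (K ω ∩ B).encard} := by
      ext ω
      simp [ENat.eq_top_iff_forall_ge]
    rw [this]
    exact MeasurableSet.iInter key
  | coe n =>
    have : ((fun K : Set α => (K ∩ B).encard) ∘ K) ⁻¹' {(n : ℕ∞)} =
        {ω | (n : ℕ∞) ≤ (K ω ∩ B).encard} \ {ω | ((n + 1 : ℕ) : ℕ∞) ≤ (K ω ∩ B).encard} := by
      ext ω
      simp only [Set.mem_preimage, Function.comp, Set.mem_singleton_iff, Set.mem_sdiff,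
        Set.mem_ofPred_eq, not_le]
      generalize (K ω ∩ B).encard = e
      induction e using ENat.recTopCoe with
      | top => simp
      | coe e => norm_cast; omega
    rw [this]
    exact (key n).diff (key (n + 1))

end MeasurablyEnumerated

/-- The sum type is embedded measurably in a product of real, finite and Boolean coordinates, where
equality is tested coordinate by coordinate. The label of a value item is repeated only to match the
shape of an exchange item. -/
instance Info.instMeasurableEq (N : ℕ) : MeasurableEq (Info N) := by
  let f : Info N → (ℝ × Fin N × Fin N × ℝ) × Bool :=
    Sum.elim (fun p => ((p.1, p.2.1, p.2.1, p.2.2), true))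
      (fun p => ((0, p.1, p.2.1, p.2.2), false))
  have hf : Measurable f := by
    refine Measurable.sumElim ?_ ?_ <;> fun_prop
  have hinj : Function.Injective f := by
    rintro (⟨v, j, s⟩ | ⟨j, i, s⟩) (⟨v', j', s'⟩ | ⟨j', i', s'⟩) h <;> simp [f] at h ⊢ <;> tauto
  have hp : MeasurableSet {p : Info N × Info N | f p.1 = f p.2} := by
    have h1 := hf.comp (measurable_fst : Measurable (Prod.fst : Info N × Info N → Info N))
    have h2 := hf.comp (measurable_snd : Measurable (Prod.snd : Info N × Info N → Info N))
    have h3 : MeasurableSet {p : Info N × Info N | (f p.1).1.1 = (f p.2).1.1} :=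
      measurableSet_eq_fun h1.fst.fst h2.fst.fst
    have h4 : MeasurableSet {p : Info N × Info N | (f p.1).1.2.1 = (f p.2).1.2.1} :=
      measurableSet_eq_fun h1.fst.snd.fst h2.fst.snd.fst
    have h5 : MeasurableSet {p : Info N × Info N | (f p.1).1.2.2.1 = (f p.2).1.2.2.1} :=
      measurableSet_eq_fun h1.fst.snd.snd.fst h2.fst.snd.snd.fst
    have h6 : MeasurableSet {p : Info N × Info N | (f p.1).1.2.2.2 = (f p.2).1.2.2.2} :=
      measurableSet_eq_fun h1.fst.snd.snd.snd h2.fst.snd.snd.snd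
    have h7 : MeasurableSet {p : Info N × Info N | (f p.1).2 = (f p.2).2} :=
      measurableSet_eq_fun h1.snd h2.snd
    convert (h3.inter (h4.inter (h5.inter (h6.inter h7)))) using 1
    ext p
    simp only [Set.mem_ofPred_eq, Set.mem_inter_iff, Prod.ext_iff]
    tauto
  refine ⟨?_⟩
  convert hp using 1
  ext p
  simp [hinj.eq_iff]

namespace MeasurablyEnumerated

theorem prod {Ω α β : Type*} [MeasurableSpace Ω] [MeasurableSpace α] [MeasurableSpace β]
    {K : Ω → Set α} {L : Ω → Set β}
    (hK : MeasurablyEnumerated K) (hL : MeasurablyEnumerated L) :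
    MeasurablyEnumerated (fun ω => K ω ×ˢ L ω) := by
  obtain ⟨E, a, hE, ha, h⟩ := hK
  obtain ⟨F, b, hF, hb, h'⟩ := hL
  refine ⟨fun n => E n.unpair.1 ∩ F n.unpair.2, fun n ω => (a n.unpair.1 ω, b n.unpair.2 ω),
    fun n => (hE _).inter (hF _), fun n => (ha _).prodMk (hb _), fun ω c => ?_⟩
  obtain ⟨c, d⟩ := c
  simp only [Set.mem_prod, h, h']
  constructor
  · rintro ⟨⟨m, hm, rfl⟩, ⟨n, hn, rfl⟩⟩
    exact ⟨Nat.pair m n, by simpa using ⟨hm, hn⟩⟩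
  · rintro ⟨n, ⟨h1, h2⟩, h3⟩
    obtain ⟨rfl, rfl⟩ := Prod.ext_iff.1 h3
    exact ⟨⟨_, h1, rfl⟩, ⟨_, h2, rfl⟩⟩

end MeasurablyEnumerated

/-! ### Enumeration of the points of a clock -/

/-- A random locally finite set of positive times whose counting process is measurable. -/
structure IsMeasurableClock {Ω : Type*} [MeasurableSpace Ω] (T : Ω → Set ℝ) : Prop where
  pos : ∀ ω, T ω ⊆ Set.Ioi 0
  locallyFinite : ∀ ω r, (T ω ∩ Set.Iic r).Finite
  measurable_count : ∀ r, Measurable fun ω => (T ω ∩ Set.Iic r).ncard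

namespace IsMeasurableClock

variable {Ω : Type*} [MeasurableSpace Ω] {T : Ω → Set ℝ}

theorem count_mono (hT : IsMeasurableClock T) (ω : Ω) :
    Monotone fun r => (T ω ∩ Set.Iic r).ncard := fun _ _ h =>
  Set.ncard_le_ncard (Set.inter_subset_inter_right _ (Set.Iic_subset_Iic.2 h))
    (hT.locallyFinite ω _)

theorem exists_mem_count_eq (hT : IsMeasurableClock T) {ω : Ω} {r : ℝ}
    (h : 0 < (T ω ∩ Set.Iic r).ncard) :
    ∃ a ∈ T ω, a ≤ r ∧ (T ω ∩ Set.Iic a).ncard = (T ω ∩ Set.Iic r).ncard := by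
  have hne := (Set.ncard_pos (hT.locallyFinite ω r)).1 h
  obtain ⟨a, ⟨ha, har⟩, hmax⟩ := Set.exists_max_image _ id (hT.locallyFinite ω r) hne
  refine ⟨a, ha, har, congrArg _ (Set.Subset.antisymm ?_ ?_)⟩
  · exact Set.inter_subset_inter_right _ (Set.Iic_subset_Iic.2 har)
  · exact fun b hb => ⟨hb.1, hmax b hb⟩

theorem exists_isLeast (hT : IsMeasurableClock T) {ω : Ω} {n : ℕ} {r : ℝ}
    (h : n < (T ω ∩ Set.Iic r).ncard) :
    ∃ a ∈ T ω, IsLeast {r | n < (T ω ∩ Set.Iic r).ncard} a := by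
  obtain ⟨b, hb, hbr, hbc⟩ := hT.exists_mem_count_eq (Nat.zero_lt_of_lt h)
  have hfin : (T ω ∩ Set.Iic r ∩ {a | n < (T ω ∩ Set.Iic a).ncard}).Finite :=
    (hT.locallyFinite ω r).subset Set.inter_subset_left
  obtain ⟨a, ⟨⟨ha, har⟩, han⟩, hmin⟩ := Set.exists_min_image _ id hfin
    ⟨b, ⟨hb, hbr⟩, by simpa [hbc] using h⟩
  refine ⟨a, ha, han, fun r' (hr' : n < _) => ?_⟩
  obtain ⟨c, hc, hcr, hcc⟩ := hT.exists_mem_count_eq (Nat.zero_lt_of_lt hr')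
  rcases le_total c r with h1 | h1
  · exact (hmin c ⟨⟨hc, h1⟩, by simpa [hcc] using hr'⟩).trans hcr
  · exact (Set.mem_Iic.1 har).trans (h1.trans hcr)

/-- Each point is recovered from its rank, the number of points strictly before it, so the
enumeration by rank misses none. -/
theorem isLeast_of_mem (hT : IsMeasurableClock T) {ω : Ω} {a : ℝ} (ha : a ∈ T ω) :
    IsLeast {r | (T ω ∩ Set.Iio a).ncard < (T ω ∩ Set.Iic r).ncard} a := by
  constructor
  · refine Set.ncard_lt_ncard ⟨Set.inter_subset_inter_right _ Set.Iio_subset_Iic_self, fun h => ?_⟩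
      (hT.locallyFinite ω a)
    exact lt_irrefl a (h ⟨ha, Set.mem_Iic.2 le_rfl⟩).2
  · intro r hr
    by_contra! hra
    refine absurd hr (not_lt.2 (Set.ncard_le_ncard (Set.inter_subset_inter_right _ ?_) ?_))
    · exact Set.Iic_subset_Iio.2 hra
    · exact (hT.locallyFinite ω a).subset
        (Set.inter_subset_inter_right _ Set.Iio_subset_Iic_self)

/-- The event that the clock has more than `n` points. -/
def present (T : Ω → Set ℝ) (n : ℕ) : Set Ω := {ω | ∃ r, n < (T ω ∩ Set.Iic r).ncard}

/-- The `n`-th point of the clock, counted from `0`. -/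
noncomputable def point (T : Ω → Set ℝ) (n : ℕ) (ω : Ω) : ℝ := sInf {r | n < (T ω ∩ Set.Iic r).ncard}

theorem measurableSet_present (hT : IsMeasurableClock T) (n : ℕ) :
    MeasurableSet (present T n) := by
  have : present T n = ⋃ k : ℕ, {ω | n < (T ω ∩ Set.Iic (k : ℝ)).ncard} := by
    ext ω
    simp only [present, Set.mem_ofPred_eq, Set.mem_iUnion]
    constructor
    · rintro ⟨r, hr⟩
      obtain ⟨k, hk⟩ := exists_nat_ge r
      exact ⟨k, hr.trans_le (hT.count_mono ω hk)⟩
    · rintro ⟨k, hk⟩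
      exact ⟨k, hk⟩
  rw [this]
  exact MeasurableSet.iUnion fun k => hT.measurable_count k (measurableSet_Ioi (a := n))

theorem point_le_iff (hT : IsMeasurableClock T) {n : ℕ} {ω : Ω} (h : ω ∈ present T n) (r : ℝ) :
    point T n ω ≤ r ↔ n < (T ω ∩ Set.Iic r).ncard := by
  obtain ⟨r', hr'⟩ := h
  obtain ⟨a, -, hl⟩ := hT.exists_isLeast hr'
  rw [point, hl.csInf_eq]
  exact ⟨fun har => lt_of_lt_of_le hl.1 (hT.count_mono ω har), fun h => hl.2 h⟩

theorem lt_count_iff (hT : IsMeasurableClock T) {n : ℕ} {ω : Ω} (r : ℝ) :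
    n < (T ω ∩ Set.Iic r).ncard ↔ ω ∈ present T n ∧ point T n ω ≤ r :=
  ⟨fun h => ⟨⟨r, h⟩, (hT.point_le_iff ⟨r, h⟩ r).2 h⟩, fun h => (hT.point_le_iff h.1 r).1 h.2⟩

theorem measurable_point (hT : IsMeasurableClock T) (n : ℕ) : Measurable (point T n) := by
  refine measurable_of_Iic fun r => ?_
  -- If the clock has at most `n` points, the infimum is that of the empty set, which is `0`; this
  -- accounts for the second piece.
  have : point T n ⁻¹' Set.Iic r = (present T n ∩ {ω | n < (T ω ∩ Set.Iic r).ncard}) ∪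
      ((present T n)ᶜ ∩ {_ω | 0 ≤ r}) := by
    ext ω
    by_cases h : ω ∈ present T n
    · simp [h, hT.point_le_iff h]
    · have : {r | n < (T ω ∩ Set.Iic r).ncard} = ∅ :=
        Set.eq_empty_iff_forall_notMem.2 fun r hr => h ⟨r, hr⟩
      simp [h, point, this]
  rw [this]
  exact ((hT.measurableSet_present n).inter (hT.measurable_count r (measurableSet_Ioi (a := n)))).union
    ((hT.measurableSet_present n).compl.inter (MeasurableSet.const _))

theorem measurablyEnumerated (hT : IsMeasurableClock T) : MeasurablyEnumerated T := by
  refine ⟨present T, point T, hT.measurableSet_present, hT.measurable_point, fun ω b => ?_⟩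
  constructor
  · intro hb
    exact ⟨_, ⟨b, (hT.isLeast_of_mem hb).1⟩, (hT.isLeast_of_mem hb).csInf_eq⟩
  · rintro ⟨n, ⟨r, hr⟩, rfl⟩
    obtain ⟨a, ha, hl⟩ := hT.exists_isLeast hr
    rw [point, hl.csInf_eq]
    exact ha

theorem measurable_count_prod (hT : IsMeasurableClock T) :
    Measurable fun p : Ω × ℝ => (T p.1 ∩ Set.Iic p.2).ncard := by
  refine measurable_of_Ioi fun n => ?_
  have : (fun p : Ω × ℝ => (T p.1 ∩ Set.Iic p.2).ncard) ⁻¹' Set.Ioi n =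
      Prod.fst ⁻¹' present T n ∩ {p | point T n p.1 ≤ p.2} := by
    ext p
    simp [hT.lt_count_iff]
  rw [this]
  exact (measurable_fst (hT.measurableSet_present n)).inter
    (measurableSet_le ((hT.measurable_point n).comp measurable_fst) measurable_snd)

/-- The value held at time `r` by the occupant whose rank is the number of replacements up to `r`
is jointly measurable. -/
theorem measurable_value_prod (hT : IsMeasurableClock T) {v : ℕ → Ω → ℝ}
    (hv : ∀ k, Measurable (v k)) :
    Measurable fun p : Ω × ℝ => v (T p.1 ∩ Set.Iic p.2).ncard p.1 := by
  have h1 : Measurable fun q : ℕ × Ω => v q.1 q.2 := measurable_from_prod_countable_right hv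
  exact h1.comp (hT.measurable_count_prod.prodMk measurable_fst)

end IsMeasurableClock

/-! ### Knowledge sets: measurability and dependence on the past -/

section PingKnows

variable {N : ℕ}

/-- The pairs `(a, s)` such that the item `a` enters the knowledge of the given agent at time `s`
after having been relayed the given number of times. -/
def pingEntries (R P : Fin N → Set ℝ) (x : Fin N → ℝ → ℝ) : ℕ → Fin N → Set (Info N × ℝ)
  | 0, l => {q | q = (Info.value (x l 0) l 0, 0)} ∪
      {q | ∃ s ∈ R l, q = (Info.value (x l s) l s, s)} ∪
      {q | ∃ s ∈ P l, ∃ j, j ≠ l ∧ q = (Info.value (x j s) j s, s)} ∪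
      {q | ∃ s ∈ P l, ∃ j, j ≠ l ∧ q = (Info.exchange j l s, s)}
  | d + 1, l => {q | ∃ j, j ≠ l ∧ ∃ p ∈ pingEntries R P x d j, p.2 < q.2 ∧ q.2 ∈ P l ∧ p.1 = q.1}

/-- Stratifying by the number of relays turns the inductive predicate into a countable union, to
which enumeration applies. Recording the entry time is enough: since knowledge only grows, being
known before a ping means having entered before it. -/
theorem pingKnows_iff (R P : Fin N → Set ℝ) (x : Fin N → ℝ → ℝ) (i : Fin N) (t : ℝ)
    (a : Info N) :
    PingKnows R P x i t a ↔ ∃ d r, r ≤ t ∧ (a, r) ∈ pingEntries R P x d i := by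
  constructor
  · intro h
    induction h with
    | init i t ht => exact ⟨0, 0, ht, Or.inl (Or.inl (Or.inl rfl))⟩
    | replacement i s t hs hst => exact ⟨0, s, hst, Or.inl (Or.inl (Or.inr ⟨s, hs, rfl⟩))⟩
    | value i j s t hji hs hst => exact ⟨0, s, hst, Or.inl (Or.inr ⟨s, hs, j, hji, rfl⟩)⟩
    | exchange i j s t hji hs hst => exact ⟨0, s, hst, Or.inr ⟨s, hs, j, hji, rfl⟩⟩
    | relay i j r s t a hji hs hst hrs h ih =>
      obtain ⟨d, r', hr', hd⟩ := ih
      exact ⟨d + 1, s, hst, j, hji, (a, r'), hd, hr'.trans_lt hrs, hs, rfl⟩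
  · rintro ⟨d, r, hr, hd⟩
    induction d generalizing i r t with
    | zero =>
      rcases hd with ((h | ⟨s, hs, h⟩) | ⟨s, hs, j, hj, h⟩) | ⟨s, hs, j, hj, h⟩ <;>
        obtain ⟨rfl, rfl⟩ := Prod.mk.inj (h : (a, r) = _)
      · exact PingKnows.init _ _ hr
      · exact PingKnows.replacement _ _ _ hs hr
      · exact PingKnows.value _ _ _ _ hj hs hr
      · exact PingKnows.exchange _ _ _ _ hj hs hr
    | succ d ih =>
      obtain ⟨j, hj, ⟨b, r'⟩, hp, hlt, hP, rfl⟩ := hd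
      exact PingKnows.relay i j r' r t _ hj hP hr hlt (ih j r' r' le_rfl hp)

variable {Ω : Type*} [MeasurableSpace Ω] {R P : Fin N → Ω → Set ℝ} {x : Ω → Fin N → ℝ → ℝ}

theorem measurablyEnumerated_pingEntries (hR : ∀ j, IsMeasurableClock (R j))
    (hP : ∀ j, IsMeasurableClock (P j)) (hx : ∀ j, Measurable fun p : Ω × ℝ => x p.1 j p.2)
    (d : ℕ) (l : Fin N) :
    MeasurablyEnumerated
      (fun ω => pingEntries (fun j => R j ω) (fun j => P j ω) (x ω) d l) := by
  have : Nonempty (Info N × ℝ) := ⟨Info.value 0 l 0, 0⟩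
  have hval : ∀ j, Measurable fun p : Ω × ℝ => ((Info.value (x p.1 j p.2) j p.2 : Info N), p.2) :=
    fun j => (measurable_inl.comp ((hx j).prodMk
      (measurable_const.prodMk measurable_snd))).prodMk measurable_snd
  have hex : ∀ l j, Measurable fun p : Ω × ℝ => ((Info.exchange j l p.2 : Info N), p.2) :=
    fun l j => (measurable_inr.comp (measurable_const.prodMk
      (measurable_const.prodMk measurable_snd))).prodMk measurable_snd
  induction d generalizing l with
  | zero =>
    refine ((MeasurablyEnumerated.union ?_ ?_).union ?_).union ?_
    · convert MeasurablyEnumerated.optional_point MeasurableSet.univ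
        ((hval l).comp (measurable_id.prodMk (measurable_const (a := (0 : ℝ))))) using 2 with ω
      ext q; simp [eq_comm]
    · convert (hR l).measurablyEnumerated.image_of MeasurableSet.univ (hval l) using 2 with ω
      ext q; simp [eq_comm]
    · convert MeasurablyEnumerated.iUnion (fun j : {j // j ≠ l} =>
        (hP l).measurablyEnumerated.image_of MeasurableSet.univ (hval j)) using 2 with ω
      ext q; simp [eq_comm]; tauto
    · convert MeasurablyEnumerated.iUnion (fun j : {j // j ≠ l} =>
        (hP l).measurablyEnumerated.image_of MeasurableSet.univ (hex l j)) using 2 with ω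
      ext q; simp [eq_comm]; tauto
  | succ d ih =>
    have hS : MeasurableSet {p : Ω × (Info N × ℝ) × ℝ | p.2.1.2 < p.2.2} :=
      measurableSet_lt measurable_snd.fst.snd measurable_snd.snd
    have hf : Measurable fun p : Ω × (Info N × ℝ) × ℝ => (p.2.1.1, p.2.2) :=
      measurable_snd.fst.fst.prodMk measurable_snd.snd
    convert MeasurablyEnumerated.iUnion (fun j : {j // j ≠ l} =>
      (MeasurablyEnumerated.prod (ih j) (hP l).measurablyEnumerated).image_of hS hf) using 2 with ω
    ext ⟨a, s⟩
    simp only [pingEntries, Set.mem_ofPred_eq, Set.mem_iUnion, Set.mem_prod, Prod.exists,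
      Subtype.exists, Prod.mk.injEq]
    constructor
    · rintro ⟨j, hj, a, r, h, hrs, hs, rfl⟩
      exact ⟨j, hj, a, r, s, ⟨h, hs⟩, hrs, rfl, rfl⟩
    · rintro ⟨j, hj, a, r, s, ⟨h, hs⟩, hrs, rfl, rfl⟩
      exact ⟨j, hj, a, r, h, hrs, hs, rfl⟩

theorem measurable_pingKnows (hR : ∀ j, IsMeasurableClock (R j))
    (hP : ∀ j, IsMeasurableClock (P j)) (hx : ∀ j, Measurable fun p : Ω × ℝ => x p.1 j p.2)
    (i : Fin N) (t : ℝ) :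
    Measurable[_, countingSigma (Info N)]
      (fun ω => {a | PingKnows (fun j => R j ω) (fun j => P j ω) (x ω) i t a}) := by
  have : Nonempty (Info N) := ⟨Info.value 0 i 0⟩
  have hS : MeasurableSet {p : Ω × Info N × ℝ | p.2.2 ≤ t} :=
    measurableSet_le measurable_snd.snd measurable_const
  have hf : Measurable fun p : Ω × Info N × ℝ => p.2.1 := measurable_snd.fst
  have := MeasurablyEnumerated.iUnion fun d =>
    (measurablyEnumerated_pingEntries hR hP hx d i).image_of hS hf
  convert this.measurable using 2 with ω
  ext a
  simp only [Set.mem_ofPred_eq, pingKnows_iff, Set.mem_iUnion, Prod.exists]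
  constructor
  · rintro ⟨d, r, hr, h⟩
    exact ⟨d, a, r, h, hr, rfl⟩
  · rintro ⟨d, b, r, h, hr, rfl⟩
    exact ⟨d, r, hr, h⟩

/-- Knowledge up to time `s` depends only on the events and on the values up to time `s`. -/
theorem PingKnows.congr_of_le {R P R' P' : Fin N → Set ℝ} {x x' : Fin N → ℝ → ℝ} {s : ℝ}
    (hRpos : ∀ j, R j ⊆ Set.Ioi 0) (hPpos : ∀ j, P j ⊆ Set.Ioi 0)
    (hR : ∀ j, ∀ r ∈ R j, r ≤ s → r ∈ R' j) (hP : ∀ j, ∀ r ∈ P j, r ≤ s → r ∈ P' j)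
    (hx : ∀ j r, 0 ≤ r → r ≤ s → x j r = x' j r) {i : Fin N} {t : ℝ} (hts : t ≤ s) {a : Info N}
    (h : PingKnows R P x i t a) : PingKnows R' P' x' i t a := by
  induction h with
  | init i t ht => rw [hx i 0 le_rfl (ht.trans hts)]; exact PingKnows.init i t ht
  | replacement i r t hr hrt =>
    rw [hx i r (hRpos i hr).le (hrt.trans hts)]
    exact PingKnows.replacement i r t (hR i r hr (hrt.trans hts)) hrt
  | value i j r t hji hr hrt =>
    rw [hx j r (hPpos i hr).le (hrt.trans hts)]
    exact PingKnows.value i j r t hji (hP i r hr (hrt.trans hts)) hrt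
  | exchange i j r t hji hr hrt =>
    exact PingKnows.exchange i j r t hji (hP i r hr (hrt.trans hts)) hrt
  | relay i j r u t a hji hu hut hru h ih =>
    exact PingKnows.relay i j r u t a hji (hP i u hu (hut.trans hts)) hut hru
      (ih (hru.le.trans (hut.trans hts)))

/-- The knowledge of an agent without pings after time `s` depends only on the events and on the
values up to time `s` and on the events that concern that agent. -/
theorem PingKnows.congr_of_no_ping {R P R' P' : Fin N → Set ℝ} {x x' : Fin N → ℝ → ℝ} {s t : ℝ}
    {i : Fin N} (hRpos : ∀ j, R j ⊆ Set.Ioi 0) (hPpos : ∀ j, P j ⊆ Set.Ioi 0)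
    (hR : ∀ j, ∀ r ∈ R j, r ≤ s → r ∈ R' j) (hP : ∀ j, ∀ r ∈ P j, r ≤ s → r ∈ P' j)
    (hx : ∀ j r, 0 ≤ r → r ≤ s → x j r = x' j r)
    (hRi : ∀ r ∈ R i, r ≤ t → r ∈ R' i) (hxi : ∀ r, 0 ≤ r → r ≤ t → x i r = x' i r)
    (hno : ∀ r ∈ P i, r ≤ t → r ≤ s) {a : Info N}
    (h : PingKnows R P x i t a) : PingKnows R' P' x' i t a := by
  cases h with
  | init i t ht => rw [hxi 0 le_rfl ht]; exact PingKnows.init i t ht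
  | replacement i r t hr hrt =>
    rw [hxi r (hRpos i hr).le hrt]
    exact PingKnows.replacement i r t (hRi r hr hrt) hrt
  | value i j r t hji hr hrt =>
    rw [hx j r (hPpos i hr).le (hno r hr hrt)]
    exact PingKnows.value i j r t hji (hP i r hr (hno r hr hrt)) hrt
  | exchange i j r t hji hr hrt =>
    exact PingKnows.exchange i j r t hji (hP i r hr (hno r hr hrt)) hrt
  -- The ping at `u` is at most `s`, and the relayed item was known to `j` before `u`; hence only
  -- knowledge up to `s` matters for the other labels.
  | relay i j r u t a hji hu hut hru h =>
    exact PingKnows.relay i j r u t a hji (hP i u hu (hno u hu hut)) hut hru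
      (h.congr_of_le hRpos hPpos hR hP hx (hru.le.trans (hno u hu hut)))

end PingKnows

/-! ### Independence of increments of a clock from its past -/

/-- If `m₁` is independent of `m₂` and `m₃` is independent of both together, then `m₁` is
independent of `m₂` and `m₃` together. -/
theorem ProbabilityTheory.Indep.indep_sup_right {Ω : Type*} {m₁ m₂ m₃ m : MeasurableSpace Ω}
    {μ : Measure Ω} [IsProbabilityMeasure μ] (h₁ : m₁ ≤ m) (h₂ : m₂ ≤ m) (h₃ : m₃ ≤ m)
    (h12 : Indep m₁ m₂ μ) (h123 : Indep (m₁ ⊔ m₂) m₃ μ) : Indep m₁ (m₂ ⊔ m₃) μ := by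
  let p : Set (Set Ω) := {s | ∃ b c, MeasurableSet[m₂] b ∧ MeasurableSet[m₃] c ∧ s = b ∩ c}
  have hp : IsPiSystem p := by
    rintro _ ⟨b, c, hb, hc, rfl⟩ _ ⟨b', c', hb', hc', rfl⟩ -
    exact ⟨b ∩ b', c ∩ c', hb.inter hb', hc.inter hc', Set.inter_inter_inter_comm ..⟩
  have hgen : m₂ ⊔ m₃ = MeasurableSpace.generateFrom p := by
    apply le_antisymm
    · refine sup_le (fun s hs => ?_) (fun s hs => ?_)
      · exact MeasurableSpace.measurableSet_generateFrom
          ⟨s, Set.univ, hs, MeasurableSet.univ, by simp⟩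
      · exact MeasurableSpace.measurableSet_generateFrom
          ⟨Set.univ, s, MeasurableSet.univ, hs, by simp⟩
    · refine MeasurableSpace.generateFrom_le ?_
      rintro _ ⟨b, c, hb, hc, rfl⟩
      exact ((le_sup_left : m₂ ≤ m₂ ⊔ m₃) _ hb).inter ((le_sup_right : m₃ ≤ m₂ ⊔ m₃) _ hc)
  refine IndepSets.indep h₁ (sup_le h₂ h₃) (@MeasurableSpace.isPiSystem_measurableSet _ m₁) hp
    (@MeasurableSpace.generateFrom_measurableSet _ m₁).symm hgen ?_
  rw [IndepSets_iff]
  rintro a _ ha ⟨b, c, hb, hc, rfl⟩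
  have hb' := (le_sup_right : m₂ ≤ m₁ ⊔ m₂) _ hb
  have ha' := (le_sup_left : m₁ ≤ m₁ ⊔ m₂) _ ha
  rw [Indep_iff] at h12 h123
  rw [← Set.inter_assoc, h123 _ _ (ha'.inter hb') hc, h12 _ _ ha hb, h123 _ _ hb' hc, mul_assoc]

theorem measurable_ncard_inter {α : Type*} [MeasurableSpace α] {B : Set α}
    (hB : MeasurableSet B) :
    Measurable[countingSigma α] fun K : Set α => (K ∩ B).ncard := by
  let _ : MeasurableSpace ℕ∞ := ⊤
  have h : Measurable[countingSigma α] fun K : Set α => (K ∩ B).encard := by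
    rw [measurable_iff_comap_le]
    exact le_iSup (fun B : {B : Set α // MeasurableSet B} =>
      MeasurableSpace.comap (fun K : Set α => (K ∩ B.1).encard) ⊤) ⟨B, hB⟩
  exact (measurable_from_top (f := ENat.toNat)).comp h

theorem measurable_ncard_timesSigma {Ω : Type*} (T : Ω → Set ℝ) {B : Set ℝ}
    (hB : MeasurableSet B) : Measurable[timesSigma T] fun ω => (T ω ∩ B).ncard :=
  (measurable_ncard_inter hB).comp (comap_measurable T)

/-- The sigma-algebra of the counting process of a random set of times up to time `s`. -/
@[reducible] noncomputable def pastSigma {Ω : Type*} (T : Ω → Set ℝ) (s : ℝ) : MeasurableSpace Ω :=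
  ⨆ r : Set.Iic s, MeasurableSpace.comap (fun ω => (T ω ∩ Set.Iic r.1).ncard) ⊤

theorem pastSigma_le_timesSigma {Ω : Type*} (T : Ω → Set ℝ) (s : ℝ) :
    pastSigma T s ≤ timesSigma T :=
  iSup_le fun _ => (measurable_ncard_timesSigma T measurableSet_Iic).comap_le

theorem measurable_count_pastSigma {Ω : Type*} (T : Ω → Set ℝ) {r s : ℝ} (h : r ≤ s) :
    Measurable[pastSigma T s] fun ω => (T ω ∩ Set.Iic r).ncard := by
  rw [measurable_iff_comap_le]
  exact le_iSup (fun r : Set.Iic s =>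
    MeasurableSpace.comap (fun ω => (T ω ∩ Set.Iic r.1).ncard) ⊤) ⟨r, h⟩

theorem isMeasurableClock_of_timesSigma_le {Ω : Type*} {m : MeasurableSpace Ω} {T : Ω → Set ℝ}
    (hpos : ∀ ω, T ω ⊆ Set.Ioi 0) (hfin : ∀ ω r, (T ω ∩ Set.Iic r).Finite)
    (hm : timesSigma T ≤ m) : IsMeasurableClock T where
  pos := hpos
  locallyFinite := hfin
  measurable_count _ := (measurable_ncard_timesSigma T measurableSet_Iic).mono hm le_rfl

namespace IsPoissonClock

variable {Ω : Type*} {m0 : MeasurableSpace Ω} {μ : Measure Ω} {T : Ω → Set ℝ} {rate : ℝ}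

theorem timesSigma_le (hT : IsPoissonClock μ T rate) : timesSigma T ≤ m0 :=
  hT.measurable.comap_le

theorem count_add (hT : IsPoissonClock μ T rate) (ω : Ω) {s t : ℝ} (hst : s ≤ t) :
    (T ω ∩ Set.Iic t).ncard = (T ω ∩ Set.Iic s).ncard + (T ω ∩ Set.Ioc s t).ncard := by
  rw [← Set.ncard_union_eq (Set.disjoint_left.2 fun a ha hb => not_lt.2 ha.2 hb.2.1)
    (hT.locallyFinite ω s) ((hT.locallyFinite ω t).subset
      (Set.inter_subset_inter_right _ Set.Ioc_subset_Iic_self)),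
    ← Set.inter_union_distrib_left, Set.Iic_union_Ioc_eq_Iic hst]

theorem count_of_nonpos (hT : IsPoissonClock μ T rate) (ω : Ω) {s : ℝ} (hs : s ≤ 0) :
    (T ω ∩ Set.Iic s).ncard = 0 := by
  have : T ω ∩ Set.Iic s = ∅ := Set.eq_empty_iff_forall_notMem.2 fun a ha =>
    not_lt.2 (ha.2.trans hs) (hT.pos ω ha.1)
  simp [this]

theorem measure_no_point (hT : IsPoissonClock μ T rate) (hrate : 0 ≤ rate) {s t : ℝ}
    (hs : 0 ≤ s) (hst : s ≤ t) :
    μ.real {ω | (T ω ∩ Set.Ioc s t).ncard = 0} = Real.exp (-rate * (t - s)) := by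
  have h := hT.increment_law s t hs hst
  have hm : Measurable fun ω => (T ω ∩ Set.Ioc s t).ncard :=
    (measurable_ncard_timesSigma T measurableSet_Ioc).mono hT.timesSigma_le le_rfl
  have h2 : μ {ω | (T ω ∩ Set.Ioc s t).ncard = 0} =
      μ.map (fun ω => (T ω ∩ Set.Ioc s t).ncard) {0} := by
    rw [Measure.map_apply hm (MeasurableSet.singleton 0)]; rfl
  have h3 : 0 ≤ rate * (t - s) := mul_nonneg hrate (sub_nonneg.2 hst)
  rw [Measure.real, h2, h, poissonMeasure_singleton, ENNReal.toReal_ofReal (by positivity)]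
  simp [Real.coe_toNNReal _ h3]

/-- The increments of a Poisson clock after time `s` are independent of its past. -/
theorem indep_pastSigma [IsProbabilityMeasure μ] (hT : IsPoissonClock μ T rate) {s t : ℝ}
    (hs : 0 ≤ s) (hst : s ≤ t) :
    Indep (MeasurableSpace.comap (fun ω => (T ω ∩ Set.Ioc s t).ncard) ⊤) (pastSigma T s) μ := by
  -- The past is the directed supremum of the sigma-algebras of finitely many counts, so
  -- independence need only be checked for those.
  let F : Finset (Set.Iic s) → MeasurableSpace Ω := fun A =>
    ⨆ r ∈ A, MeasurableSpace.comap (fun ω => (T ω ∩ Set.Iic r.1).ncard) ⊤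
  have hFle : ∀ A, F A ≤ m0 := fun A => iSup₂_le fun r _ =>
    ((measurable_ncard_timesSigma T measurableSet_Iic).mono hT.timesSigma_le le_rfl).comap_le
  have hDle : MeasurableSpace.comap (fun ω => (T ω ∩ Set.Ioc s t).ncard) ⊤ ≤ m0 :=
    ((measurable_ncard_timesSigma T measurableSet_Ioc).mono hT.timesSigma_le le_rfl).comap_le
  have hdir : Directed (· ≤ ·) F := by
    classical
    exact directed_of_isDirected_le fun A B hAB => biSup_mono fun r hr => Finset.mem_of_subset hAB hr
  have hsup : pastSigma T s = ⨆ A, F A := by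
    apply le_antisymm
    · exact iSup_le fun r => le_iSup_of_le {r} (le_iSup₂_of_le r (by simp) le_rfl)
    · exact iSup_le fun A => iSup₂_le fun r _ => le_iSup (fun r : Set.Iic s =>
        MeasurableSpace.comap (fun ω => (T ω ∩ Set.Iic r.1).ncard) ⊤) r
  rw [hsup]
  refine (indep_iSup_of_directed_le (fun A => ?_) hFle hDle hdir).symm
  classical
  -- Negative times are dropped because their counts vanish. Adding `0` and `s` makes the increments
  -- between consecutive times start at `0` and end at `s`.
  let A' : Finset ℝ := insert s (insert 0 ((A.image Subtype.val).filter (0 ≤ ·)))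
  have hA' : ∀ r ∈ A', 0 ≤ r ∧ r ≤ s := by
    intro r hr
    simp only [A', Finset.mem_insert, Finset.mem_filter, Finset.mem_image] at hr
    rcases hr with rfl | rfl | ⟨⟨a, -, rfl⟩, hr⟩
    · exact ⟨hs, le_rfl⟩
    · exact ⟨le_rfl, hs⟩
    · exact ⟨hr, a.2⟩
  let c := A'.card
  have hcpos : 0 < c := Finset.card_pos.2 ⟨s, Finset.mem_insert_self _ _⟩
  let e := A'.orderEmbOfFin rfl
  have he : ∀ k, e k ∈ A' := fun k => A'.orderEmbOfFin_mem rfl k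
  have hsurj : ∀ r ∈ A', ∃ k, e k = r := fun r hr => by
    have : r ∈ Set.range e := by rw [A'.range_orderEmbOfFin rfl]; exact hr
    exact this
  -- The times in increasing order, then `t` forever: increment number `c - 1` is the one over `(s,
  -- t]`, and those before it add up to the counts.
  let u : ℕ → ℝ := fun k => if h : k < c then e ⟨k, h⟩ else t
  have hule : ∀ k (h : k < c), u k = e ⟨k, h⟩ := fun k h => by simp [u, h]
  have hu0 : u 0 = 0 := by
    obtain ⟨k, hk⟩ := hsurj 0 (by simp [A'])
    have h1 : e ⟨0, hcpos⟩ ≤ e k := e.monotone (Fin.mk_le_of_le_val (Nat.zero_le _))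
    rw [hule 0 hcpos]
    exact le_antisymm (hk ▸ h1) (hA' _ (he _)).1
  have hmono : Monotone u := by
    intro k l hkl
    by_cases hl : l < c
    · rw [hule l hl, hule k (hkl.trans_lt hl)]
      exact e.monotone hkl
    · have : u l = t := by simp [u, hl]
      rw [this]
      by_cases hk : k < c
      · rw [hule k hk]; exact (hA' _ (he _)).2.trans hst
      · simp [u, hk]
  have hlast : u (c - 1) = s := by
    obtain ⟨k, hk⟩ := hsurj s (by simp [A'])
    have hc1 : c - 1 < c := by omega
    have h1 : e k ≤ e ⟨c - 1, hc1⟩ := e.monotone (Fin.mk_le_mk.2 (by have := k.2; omega))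
    rw [hule _ hc1]
    exact le_antisymm (hA' _ (he _)).2 (hk ▸ h1)
  have hc : u (c - 1 + 1) = t := by simp [u]; omega
  have hind := hT.increments_indep u hu0.ge hmono
  have hincle : ∀ k, MeasurableSpace.comap
      (fun ω => (T ω ∩ Set.Ioc (u k) (u (k + 1))).ncard) (⊤ : MeasurableSpace ℕ) ≤ m0 := fun k =>
    ((measurable_ncard_timesSigma T measurableSet_Ioc).mono hT.timesSigma_le le_rfl).comap_le
  have hI := indep_iSup_of_disjoint hincle hind (S := Set.Iio (c - 1)) (T := {c - 1}) (by simp)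
  have hcount : ∀ k, k < c → Measurable[⨆ l ∈ Set.Iio (c - 1), MeasurableSpace.comap
      (fun ω => (T ω ∩ Set.Ioc (u l) (u (l + 1))).ncard) (⊤ : MeasurableSpace ℕ)]
      fun ω => (T ω ∩ Set.Iic (u k)).ncard := by
    intro k
    induction k with
    | zero =>
      intro _
      simp only [hu0, hT.count_of_nonpos _ le_rfl]
      exact measurable_const
    | succ k ih =>
      intro hk
      simp only [hT.count_add _ (hmono (Nat.le_succ k))]
      refine Measurable.add (ih (by omega)) ?_
      rw [measurable_iff_comap_le]
      exact le_iSup₂ (f := fun l (_ : l ∈ Set.Iio (c - 1)) => MeasurableSpace.comap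
        (fun ω => (T ω ∩ Set.Ioc (u l) (u (l + 1))).ncard) (⊤ : MeasurableSpace ℕ)) k
        (Set.mem_Iio.2 (by omega))
  refine indep_of_indep_of_le_left (indep_of_indep_of_le_right hI ?_) ?_
  · refine le_iSup₂_of_le (c - 1) rfl ?_
    rw [hlast, hc]
  · refine iSup₂_le fun r hr => ?_
    by_cases h0 : 0 ≤ r.1
    · obtain ⟨k, hk⟩ := hsurj r.1 (Finset.mem_insert_of_mem (Finset.mem_insert_of_mem
        (Finset.mem_filter.2 ⟨Finset.mem_image_of_mem _ hr, h0⟩)))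
      have := hcount k.1 k.2
      rw [hule k.1 k.2, Fin.eta, hk] at this
      exact this.comap_le
    · simp only [hT.count_of_nonpos _ (le_of_not_ge h0)]
      exact measurable_const.comap_le

end IsPoissonClock

/-! ### Sigma-algebras of the model and their independence -/

namespace PingModel

variable {Ω : Type*} {m0 : MeasurableSpace Ω} {μ : Measure Ω} {N : ℕ} {lamR lamP σ : ℝ}

/-- The number of replacements at label `i` up to time `t`. -/
noncomputable abbrev count (M : PingModel μ N lamR lamP σ) (i : Fin N) (t : ℝ) (ω : Ω) : ℕ :=
  (M.replacements i ω ∩ Set.Iic t).ncard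

/-- The sigma-algebra of the Ping clocks. -/
@[reducible] noncomputable def pingSigma (M : PingModel μ N lamR lamP σ) : MeasurableSpace Ω :=
  ⨆ i, timesSigma (M.pings i)

/-- The sigma-algebra of the replacement clocks of the labels in `S`. -/
@[reducible] noncomputable def replacementSigma (M : PingModel μ N lamR lamP σ) (S : Set (Fin N)) :
    MeasurableSpace Ω :=
  ⨆ i ∈ S, timesSigma (M.replacements i)

/-- The sigma-algebra of the values attributed to the agents in `S`. -/
@[reducible] noncomputable def valueSigma (M : PingModel μ N lamR lamP σ) (S : Set (Fin N × ℕ)) :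
    MeasurableSpace Ω :=
  ⨆ q ∈ S, MeasurableSpace.comap (M.attributed q.1 q.2) inferInstance

variable (M : PingModel μ N lamR lamP σ)

theorem pingSigma_le : M.pingSigma ≤ m0 := iSup_le fun i => (M.pings_clock i).timesSigma_le

theorem replacementSigma_le (S : Set (Fin N)) : M.replacementSigma S ≤ m0 :=
  iSup₂_le fun i _ => (M.replacements_clock i).timesSigma_le

theorem valueSigma_le (S : Set (Fin N × ℕ)) : M.valueSigma S ≤ m0 :=
  iSup₂_le fun q _ => (M.attributed_measurable q.1 q.2).comap_le

theorem timesSigma_le_pingSigma (i : Fin N) : timesSigma (M.pings i) ≤ M.pingSigma :=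
  le_iSup (fun i => timesSigma (M.pings i)) i

theorem timesSigma_le_replacementSigma {S : Set (Fin N)} {i : Fin N} (hi : i ∈ S) :
    timesSigma (M.replacements i) ≤ M.replacementSigma S :=
  le_iSup₂ (f := fun i (_ : i ∈ S) => timesSigma (M.replacements i)) i hi

theorem comap_le_valueSigma {S : Set (Fin N × ℕ)} {i : Fin N} {k : ℕ} (h : (i, k) ∈ S) :
    MeasurableSpace.comap (M.attributed i k) inferInstance ≤ M.valueSigma S :=
  le_iSup₂ (f := fun (q : Fin N × ℕ) (_ : q ∈ S) =>
    MeasurableSpace.comap (M.attributed q.1 q.2) inferInstance) (i, k) h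

theorem valueSigma_mono {S S' : Set (Fin N × ℕ)} (h : S ⊆ S') :
    M.valueSigma S ≤ M.valueSigma S' := biSup_mono h

theorem replacementSigma_mono {S S' : Set (Fin N)} (h : S ⊆ S') :
    M.replacementSigma S ≤ M.replacementSigma S' := biSup_mono h

theorem measurable_count (i : Fin N) (t : ℝ) :
    Measurable[timesSigma (M.replacements i)] (M.count i t) :=
  measurable_ncard_timesSigma _ measurableSet_Iic

theorem measurableSet_count_eq (i : Fin N) (t : ℝ) (k : ℕ) :
    MeasurableSet[timesSigma (M.replacements i)] {ω | M.count i t ω = k} :=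
  M.measurable_count i t (MeasurableSet.singleton k)

theorem indep_replacements_values :
    Indep (M.replacementSigma Set.univ) (M.valueSigma Set.univ) μ := by
  refine indep_of_indep_of_le_left (indep_of_indep_of_le_right M.replacements_indep_values ?_) ?_
  · exact iSup₂_le fun q _ => le_iSup₂ (f := fun i k =>
      MeasurableSpace.comap (M.attributed i k) inferInstance) q.1 q.2
  · exact iSup₂_le fun i _ => le_iSup (fun i => timesSigma (M.replacements i)) i

theorem indep_replacements_values_pings :
    Indep (M.replacementSigma Set.univ ⊔ M.valueSigma Set.univ) M.pingSigma μ := by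
  refine indep_of_indep_of_le_left M.pings_indep.symm (sup_le_sup ?_ ?_)
  · exact iSup₂_le fun i _ => le_iSup (fun i => timesSigma (M.replacements i)) i
  · exact iSup₂_le fun q _ => le_iSup₂ (f := fun i k =>
      MeasurableSpace.comap (M.attributed i k) inferInstance) q.1 q.2

/-- The sigma-algebra of all clocks, and of all attributed values but the `n`-th one of `j`. -/
@[reducible] noncomputable def exceptSigma (j : Fin N) (n : ℕ) : MeasurableSpace Ω :=
  M.valueSigma {(j, n)}ᶜ ⊔ M.replacementSigma Set.univ ⊔ M.pingSigma

theorem exceptSigma_le (j : Fin N) (n : ℕ) : M.exceptSigma j n ≤ m0 :=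
  sup_le (sup_le (M.valueSigma_le _) (M.replacementSigma_le _)) M.pingSigma_le

/-- The other values, the replacements and the pings are adjoined one block at a time, each block
being independent of all that precedes. -/
theorem indep_exceptSigma [IsProbabilityMeasure μ] (j : Fin N) (n : ℕ) :
    Indep (MeasurableSpace.comap (M.attributed j n) inferInstance) (M.exceptSigma j n) μ := by
  have hle := (M.attributed_measurable j n).comap_le
  have hsub : MeasurableSpace.comap (M.attributed j n) inferInstance ≤ M.valueSigma Set.univ :=
    M.comap_le_valueSigma (Set.mem_univ _)
  have hsup : MeasurableSpace.comap (M.attributed j n) inferInstance ⊔ M.valueSigma {(j, n)}ᶜ ≤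
      M.valueSigma Set.univ := sup_le hsub (M.valueSigma_mono (Set.subset_univ _))
  have h1 : Indep (MeasurableSpace.comap (M.attributed j n) inferInstance)
      (M.valueSigma {(j, n)}ᶜ) μ := by
    have := indep_iSup_of_disjoint
      (fun q : Fin N × ℕ => (M.attributed_measurable q.1 q.2).comap_le) M.attributed_indep
      (S := {(j, n)}) (T := {(j, n)}ᶜ) disjoint_compl_right
    rw [iSup_singleton] at this
    exact this
  have h2 := h1.indep_sup_right hle (M.valueSigma_le _) (M.replacementSigma_le Set.univ)
    (indep_of_indep_of_le_left M.indep_replacements_values.symm hsup)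
  refine h2.indep_sup_right hle (sup_le (M.valueSigma_le _) (M.replacementSigma_le _))
    M.pingSigma_le (indep_of_indep_of_le_left M.indep_replacements_values_pings ?_)
  rw [← sup_assoc, sup_comm (M.replacementSigma Set.univ)]
  exact sup_le_sup_right hsup _

/-- The sigma-algebra of the Ping clocks, of all values, of the replacement clocks of the labels
other than `j` and of the replacement clock of `j` up to time `s`. -/
@[reducible] noncomputable def beforeSigma (j : Fin N) (s : ℝ) : MeasurableSpace Ω :=
  pastSigma (M.replacements j) s ⊔ M.replacementSigma {j}ᶜ ⊔ M.valueSigma Set.univ ⊔ M.pingSigma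

theorem beforeSigma_le (j : Fin N) (s : ℝ) : M.beforeSigma j s ≤ m0 :=
  sup_le (sup_le (sup_le ((pastSigma_le_timesSigma _ _).trans
    (M.replacements_clock j).timesSigma_le) (M.replacementSigma_le _)) (M.valueSigma_le _))
    M.pingSigma_le

/-- The blocks are adjoined in turn: past of the clock, other replacement clocks, all values, pings.
No value needs to be left out, since values are independent of replacements. -/
theorem indep_beforeSigma [IsProbabilityMeasure μ] (j : Fin N) {s t : ℝ} (hs : 0 ≤ s) (hst : s ≤ t) :
    Indep (MeasurableSpace.comap (fun ω => (M.replacements j ω ∩ Set.Ioc s t).ncard) ⊤)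
      (M.beforeSigma j s) μ := by
  have hD : MeasurableSpace.comap (fun ω => (M.replacements j ω ∩ Set.Ioc s t).ncard) ⊤ ≤
      timesSigma (M.replacements j) := (measurable_ncard_timesSigma _ measurableSet_Ioc).comap_le
  have hpast := pastSigma_le_timesSigma (M.replacements j) s
  have hT := (M.replacements_clock j).timesSigma_le
  have hR : timesSigma (M.replacements j) ≤ M.replacementSigma Set.univ :=
    M.timesSigma_le_replacementSigma (Set.mem_univ _)
  have h1 := (M.replacements_clock j).indep_pastSigma hs hst
  have h2 : Indep (timesSigma (M.replacements j)) (M.replacementSigma {j}ᶜ) μ := by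
    have := indep_iSup_of_disjoint (fun i => (M.replacements_clock i).timesSigma_le)
      M.replacements_indep (S := {j}) (T := {j}ᶜ) disjoint_compl_right
    rw [iSup_singleton] at this
    exact this
  have h3 := h1.indep_sup_right (hD.trans hT) (hpast.trans hT) (M.replacementSigma_le {j}ᶜ)
    (indep_of_indep_of_le_left h2 (sup_le hD hpast))
  have hle3 : pastSigma (M.replacements j) s ⊔ M.replacementSigma {j}ᶜ ≤
      M.replacementSigma Set.univ :=
    sup_le (hpast.trans hR) (M.replacementSigma_mono (Set.subset_univ _))
  have h4 := h3.indep_sup_right (hD.trans hT) (hle3.trans (M.replacementSigma_le _))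
    (M.valueSigma_le Set.univ)
    (indep_of_indep_of_le_left M.indep_replacements_values (sup_le (hD.trans hR) hle3))
  exact h4.indep_sup_right (hD.trans hT)
    (sup_le (hle3.trans (M.replacementSigma_le _)) (M.valueSigma_le _)) M.pingSigma_le
    (indep_of_indep_of_le_left M.indep_replacements_values_pings
      (sup_le ((hD.trans hR).trans le_sup_left) (sup_le_sup_right hle3 _)))

end PingModel

/-! ### Prediction of a held value -/

theorem measurable_apply_nat {Ω β : Type*} {m : MeasurableSpace Ω} [MeasurableSpace β] {n : Ω → ℕ}
    {v : ℕ → Ω → β} (hn : Measurable n) (hv : ∀ k, Measurable (v k)) :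
    Measurable fun ω => v (n ω) ω :=
  (measurable_from_prod_countable_right (f := fun q : ℕ × Ω => v q.1 q.2) hv).comp
    (hn.prodMk measurable_id)

theorem setIntegral_iUnion_eq_zero {Ω ι : Type*} [Countable ι] {m : MeasurableSpace Ω}
    {μ : Measure Ω} {f : Ω → ℝ} (hf : Integrable f μ) {s : ι → Set Ω}
    (hs : ∀ i, MeasurableSet (s i)) (hd : Pairwise (Function.onFun Disjoint s))
    (h : ∀ i, ∫ ω in s i, f ω ∂μ = 0) : ∫ ω in ⋃ i, s i, f ω ∂μ = 0 := by
  rw [integral_iUnion hs hd hf.integrableOn]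
  simp [h]

namespace PingModel

variable {Ω : Type*} {m0 : MeasurableSpace Ω} {μ : Measure Ω} {N : ℕ} {lamR lamP σ : ℝ}
variable (M : PingModel μ N lamR lamP σ)

/-- The sigma-algebra of everything but the replacements and the values at label `j`. -/
@[reducible] noncomputable def unseenSigma (j : Fin N) : MeasurableSpace Ω :=
  M.valueSigma {q | q.1 ≠ j} ⊔ M.replacementSigma {j}ᶜ ⊔ M.pingSigma

theorem unseenSigma_le_exceptSigma (j : Fin N) (n : ℕ) :
    M.unseenSigma j ≤ M.exceptSigma j n := by
  refine sup_le_sup_right (sup_le_sup (M.valueSigma_mono ?_)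
    (M.replacementSigma_mono (Set.subset_univ _))) _
  rintro ⟨i, k⟩ (hi : i ≠ j) h
  exact hi (congrArg Prod.fst h)

theorem unseenSigma_le_beforeSigma (j : Fin N) (s : ℝ) :
    M.unseenSigma j ≤ M.beforeSigma j s :=
  sup_le (sup_le ((M.valueSigma_mono (Set.subset_univ _)).trans
    (le_sup_right.trans le_sup_left)) (le_sup_right.trans (le_sup_left.trans le_sup_left)))
    le_sup_right

theorem replacements_le_exceptSigma (i j : Fin N) (n : ℕ) :
    timesSigma (M.replacements i) ≤ M.exceptSigma j n :=
  (M.timesSigma_le_replacementSigma (Set.mem_univ i)).trans (le_sup_right.trans le_sup_left)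

/-- The sigma-algebra of the events that do not depend on the replacements at label `j` after time
`s`, nor on the values of the agents that arrive at label `j` after time `s`. -/
@[reducible] noncomputable def stoppedSigma (j : Fin N) (s : ℝ) : MeasurableSpace Ω where
  -- The first condition forbids the clock of `j` after `s` but allows all values. The second allows
  -- all clocks but, when `m` agents have arrived by `s`, forbids any single value of rank `n > m`.
  -- Each matches one of `indep_beforeSigma` and `indep_exceptSigma`.
  MeasurableSet' A := MeasurableSet[M.beforeSigma j s] A ∧ ∀ m n, m < n →
    MeasurableSet[M.exceptSigma j n] (A ∩ {ω | M.count j s ω = m})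
  measurableSet_empty := ⟨@MeasurableSet.empty _ (M.beforeSigma j s), fun m n _ => by
    rw [Set.empty_inter]; exact @MeasurableSet.empty _ (M.exceptSigma j n)⟩
  measurableSet_compl A hA := ⟨hA.1.compl, fun m n hmn => by
    have h1 := hA.2 m n hmn
    have h2 := M.replacements_le_exceptSigma j j n _ (M.measurableSet_count_eq j s m)
    have : Aᶜ ∩ {ω | M.count j s ω = m} =
        {ω | M.count j s ω = m} \ (A ∩ {ω | M.count j s ω = m}) := by
      ext ω; simp; tauto
    rw [this]
    exact h2.diff h1⟩
  measurableSet_iUnion A hA := ⟨MeasurableSet.iUnion fun i => (hA i).1, fun m n hmn => by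
    rw [Set.iUnion_inter]
    exact MeasurableSet.iUnion fun i => (hA i).2 m n hmn⟩

theorem stoppedSigma_le_beforeSigma (j : Fin N) (s : ℝ) :
    M.stoppedSigma j s ≤ M.beforeSigma j s := fun _ h => h.1

theorem unseenSigma_le_stoppedSigma (j : Fin N) (s : ℝ) :
    M.unseenSigma j ≤ M.stoppedSigma j s := fun A hA =>
  ⟨M.unseenSigma_le_beforeSigma j s A hA, fun m n _ =>
    (M.unseenSigma_le_exceptSigma j n A hA).inter
      (M.replacements_le_exceptSigma j j n _ (M.measurableSet_count_eq j s m))⟩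

theorem pastSigma_le_stoppedSigma (j : Fin N) (s : ℝ) :
    pastSigma (M.replacements j) s ≤ M.stoppedSigma j s := fun A hA =>
  ⟨(le_sup_left.trans (le_sup_left.trans le_sup_left) :
      pastSigma (M.replacements j) s ≤ M.beforeSigma j s) A hA, fun m n _ =>
    ((pastSigma_le_timesSigma _ _).trans (M.replacements_le_exceptSigma j j n) A hA).inter
      (M.replacements_le_exceptSigma j j n _ (M.measurableSet_count_eq j s m))⟩

theorem measurable_attributed_beforeSigma (j : Fin N) (s : ℝ) (i : Fin N) (k : ℕ) :
    Measurable[M.beforeSigma j s] (M.attributed i k) := by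
  rw [measurable_iff_comap_le]
  exact (M.comap_le_valueSigma (Set.mem_univ (i, k))).trans (le_sup_right.trans le_sup_left)

theorem measurable_attributed_exceptSigma {j i : Fin N} {n k : ℕ} (h : (i, k) ≠ (j, n)) :
    Measurable[M.exceptSigma j n] (M.attributed i k) := by
  rw [measurable_iff_comap_le]
  exact (M.comap_le_valueSigma (S := {(j, n)}ᶜ) h).trans (le_sup_left.trans le_sup_left)

theorem measurable_attributed_unseenSigma {j i : Fin N} {k : ℕ} (h : i ≠ j) :
    Measurable[M.unseenSigma j] (M.attributed i k) := by
  rw [measurable_iff_comap_le]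
  exact (M.comap_le_valueSigma (S := {q | q.1 ≠ j}) h).trans (le_sup_left.trans le_sup_left)

theorem replacements_le_unseenSigma {j i : Fin N} (h : i ≠ j) :
    timesSigma (M.replacements i) ≤ M.unseenSigma j :=
  (M.timesSigma_le_replacementSigma (S := {j}ᶜ) h).trans (le_sup_right.trans le_sup_left)

/-- Truncating the rank at the count at time `s` prevents reading the value of a later arrival:
where that count is `m < n`, the rank read is at most `m`, hence not `n`. -/
theorem measurable_stopped_attributed (j : Fin N) (s : ℝ) (k : ℕ) :
    Measurable[M.stoppedSigma j s] fun ω => M.attributed j (min k (M.count j s ω)) ω := by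
  intro B hB
  refine ⟨?_, fun m n hmn => ?_⟩
  · have hc : Measurable[M.beforeSigma j s] (M.count j s) :=
      (measurable_count_pastSigma (M.replacements j) le_rfl).mono
        (le_sup_left.trans (le_sup_left.trans le_sup_left)) le_rfl
    exact measurable_apply_nat (v := fun n ω => M.attributed j (min k n) ω) hc
      (fun n => M.measurable_attributed_beforeSigma j s j _) hB
  · have : (fun ω => M.attributed j (min k (M.count j s ω)) ω) ⁻¹' B ∩
        {ω | M.count j s ω = m} = M.attributed j (min k m) ⁻¹' B ∩ {ω | M.count j s ω = m} := by
      ext ω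
      simp only [Set.mem_inter_iff, Set.mem_preimage, Set.mem_ofPred_eq]
      exact and_congr_left fun h => by rw [h]
    rw [this]
    refine MeasurableSet.inter (M.measurable_attributed_exceptSigma ?_ hB)
      (M.replacements_le_exceptSigma j j n _ (M.measurableSet_count_eq j s m))
    intro h
    have := congrArg Prod.snd h
    simp only at this
    omega

theorem measurable_indicator_exceptSigma {j : Fin N} {s : ℝ} {G : Ω → ℝ}
    (hG : Measurable[M.stoppedSigma j s] G) {m n : ℕ} (hmn : m < n) :
    Measurable[M.exceptSigma j n] ({ω | M.count j s ω = m}.indicator G) := by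
  intro B hB
  have hm := M.replacements_le_exceptSigma j j n _ (M.measurableSet_count_eq j s m)
  have : {ω | M.count j s ω = m}.indicator G ⁻¹' B = (G ⁻¹' B ∩ {ω | M.count j s ω = m}) ∪
      ({ω | M.count j s ω = m}ᶜ ∩ {_ω | (0 : ℝ) ∈ B}) := by
    ext ω
    by_cases h : ω ∈ {ω | M.count j s ω = m}
    · simp only [Set.mem_preimage, Set.indicator_of_mem h, Set.mem_union, Set.mem_inter_iff, h,
        Set.mem_compl_iff, and_true, not_true_eq_false, false_and, or_false]
    · simp only [Set.mem_preimage, Set.indicator_of_notMem h, Set.mem_union, Set.mem_inter_iff, h,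
        Set.mem_compl_iff, and_false, not_false_eq_true, true_and, false_or, Set.mem_ofPred_eq]
  rw [this]
  exact ((hG hB).2 m n hmn).union (hm.compl.inter (MeasurableSet.const _))

theorem measurable_heldValue (j : Fin N) (r : ℝ) : Measurable fun ω => M.heldValue ω j r :=
  measurable_apply_nat ((M.measurable_count j r).mono (M.replacements_clock j).timesSigma_le le_rfl)
    (M.attributed_measurable j)

theorem measurable_heldValue_unseenSigma {j i : Fin N} (h : i ≠ j) (r : ℝ) :
    Measurable[M.unseenSigma j] fun ω => M.heldValue ω i r :=
  measurable_apply_nat ((M.measurable_count i r).mono (M.replacements_le_unseenSigma h) le_rfl)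
    (fun _ => M.measurable_attributed_unseenSigma h)

theorem count_mono (j : Fin N) (ω : Ω) {r s : ℝ} (h : r ≤ s) : M.count j r ω ≤ M.count j s ω := by
  have := (M.replacements_clock j).count_add ω h
  simp only [count, this, Nat.le_add_right]

theorem measurable_heldValue_stoppedSigma (j : Fin N) (s : ℝ) :
    Measurable[M.stoppedSigma j s] fun ω => M.heldValue ω j s := by
  have := measurable_apply_nat ((measurable_count_pastSigma (M.replacements j) (le_refl s)).mono
    (M.pastSigma_le_stoppedSigma j s) le_rfl) (fun k => M.measurable_stopped_attributed j s k)
  simp only [min_self] at this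
  exact this

theorem integral_attributed (j : Fin N) (n : ℕ) : ∫ ω, M.attributed j n ω ∂μ = 0 := by
  rw [← M.valueLaw_mean, ← M.attributed_law j n,
    integral_map (M.attributed_measurable j n).aemeasurable (by fun_prop)]

theorem lintegral_attributed_sq (j : Fin N) (n : ℕ) :
    ∫⁻ ω, ENNReal.ofReal (M.attributed j n ω ^ 2) ∂μ = ENNReal.ofReal (σ ^ 2) := by
  rw [← M.valueLaw_variance, ofReal_integral_eq_lintegral_ofReal M.valueLaw_memLp.integrable_sq
    (Filter.Eventually.of_forall fun v => sq_nonneg v), ← M.attributed_law j n,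
    lintegral_map (by fun_prop) (M.attributed_measurable j n)]

variable [IsProbabilityMeasure μ]

/-- Independence and a zero mean. No integrability of `H` is required, as the product formula also
holds with the default value of the integral. -/
theorem integral_attributed_mul (j : Fin N) (n : ℕ) {H : Ω → ℝ}
    (hH : Measurable[M.exceptSigma j n] H) : ∫ ω, M.attributed j n ω * H ω ∂μ = 0 := by
  have hind : IndepFun (M.attributed j n) H μ := by
    rw [IndepFun_iff_Indep]
    exact indep_of_indep_of_le_right (M.indep_exceptSigma j n) hH.comap_le
  rw [hind.integral_fun_mul_eq_mul_integral (M.attributed_measurable j n).aestronglyMeasurable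
    (hH.mono (M.exceptSigma_le j n) le_rfl).aestronglyMeasurable, M.integral_attributed, zero_mul]

/-- On the event that the current rank is `n`, the held value is the `n`-th attributed one, which is
independent of that event and of the pings. Lower integrals are used because square integrability of
the held value is deduced from this. -/
theorem setLIntegral_heldValue_sq (j : Fin N) (r : ℝ) {E : Set Ω}
    (hE : MeasurableSet[M.pingSigma] E) :
    ∫⁻ ω in E, ENNReal.ofReal (M.heldValue ω j r ^ 2) ∂μ = μ E * ENNReal.ofReal (σ ^ 2) := by
  have hEn : ∀ n, MeasurableSet[M.exceptSigma j n] (E ∩ {ω | M.count j r ω = n}) := fun n =>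
    ((le_sup_right : M.pingSigma ≤ M.exceptSigma j n) _ hE).inter
      (M.replacements_le_exceptSigma j j n _ (M.measurableSet_count_eq j r n))
  have hEn' : ∀ n, MeasurableSet (E ∩ {ω | M.count j r ω = n}) :=
    fun n => M.exceptSigma_le j n _ (hEn n)
  have hU : E = ⋃ n, E ∩ {ω | M.count j r ω = n} := by
    ext ω; simp
  have hd : Pairwise (Function.onFun Disjoint fun n => E ∩ {ω | M.count j r ω = n}) := by
    intro m n hmn
    exact Set.disjoint_left.2 fun ω h1 h2 => hmn (h1.2.symm.trans h2.2)
  have hpiece : ∀ n, ∫⁻ ω in E ∩ {ω | M.count j r ω = n},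
      ENNReal.ofReal (M.heldValue ω j r ^ 2) ∂μ =
      μ (E ∩ {ω | M.count j r ω = n}) * ENNReal.ofReal (σ ^ 2) := by
    intro n
    have h1 : ∫⁻ ω in E ∩ {ω | M.count j r ω = n}, ENNReal.ofReal (M.heldValue ω j r ^ 2) ∂μ =
        ∫⁻ ω in E ∩ {ω | M.count j r ω = n}, ENNReal.ofReal (M.attributed j n ω ^ 2) ∂μ := by
      refine setLIntegral_congr_fun (hEn' n) fun ω hω => ?_
      have : M.count j r ω = n := hω.2
      simp only [heldValue, this]
    rw [h1, ← lintegral_indicator (hEn' n)]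
    have h2 : ∀ ω, (E ∩ {ω | M.count j r ω = n}).indicator
        (fun ω => ENNReal.ofReal (M.attributed j n ω ^ 2)) ω =
        ENNReal.ofReal (M.attributed j n ω ^ 2) *
          (E ∩ {ω | M.count j r ω = n}).indicator (fun _ => 1) ω := by
      intro ω
      by_cases h : ω ∈ E ∩ {ω | M.count j r ω = n} <;> simp [h]
    simp only [h2]
    have h3 : ∫⁻ ω, ENNReal.ofReal (M.attributed j n ω ^ 2) *
        (E ∩ {ω | M.count j r ω = n}).indicator (fun _ => 1) ω ∂μ =
        (∫⁻ ω, ENNReal.ofReal (M.attributed j n ω ^ 2) ∂μ) *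
          ∫⁻ ω, (E ∩ {ω | M.count j r ω = n}).indicator (fun _ => 1) ω ∂μ :=
      lintegral_mul_eq_lintegral_mul_lintegral_of_independent_measurableSpace
        (M.attributed_measurable j n).comap_le (M.exceptSigma_le j n) (M.indep_exceptSigma j n)
        (((measurable_id.pow_const 2).ennreal_ofReal).comp (comap_measurable _))
        (measurable_const.indicator (hEn n))
    rw [h3, M.lintegral_attributed_sq,
      lintegral_indicator (hEn' n), setLIntegral_one, mul_comm]
  conv_lhs => rw [hU]
  rw [lintegral_iUnion hEn' hd]
  simp only [hpiece]
  rw [ENNReal.tsum_mul_right, ← measure_iUnion hd hEn', ← hU]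

theorem memLp_heldValue (j : Fin N) (r : ℝ) : MemLp (fun ω => M.heldValue ω j r) 2 μ := by
  rw [memLp_two_iff_integrable_sq (M.measurable_heldValue j r).aestronglyMeasurable]
  refine ⟨((M.measurable_heldValue j r).pow_const 2).aestronglyMeasurable, ?_⟩
  rw [hasFiniteIntegral_iff_ofReal (Filter.Eventually.of_forall fun ω => sq_nonneg _)]
  have := M.setLIntegral_heldValue_sq j r (E := Set.univ) MeasurableSet.univ
  rw [Measure.restrict_univ] at this
  rw [this]
  exact ENNReal.mul_lt_top (measure_lt_top _ _) ENNReal.ofReal_lt_top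

theorem setIntegral_heldValue_sq (j : Fin N) (r : ℝ) {E : Set Ω}
    (hE : MeasurableSet[M.pingSigma] E) :
    ∫ ω in E, M.heldValue ω j r ^ 2 ∂μ = μ.real E * σ ^ 2 := by
  rw [integral_eq_lintegral_of_nonneg_ae (Filter.Eventually.of_forall fun ω => sq_nonneg _)
    ((M.measurable_heldValue j r).pow_const 2).aestronglyMeasurable,
    M.setLIntegral_heldValue_sq j r hE, ENNReal.toReal_mul,
    ENNReal.toReal_ofReal (sq_nonneg σ), Measure.real]

/-- Without information on label `j`, the value held there cannot be predicted. -/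
theorem integral_heldValue_mul_of_unseenSigma (j : Fin N) (t : ℝ) {G : Ω → ℝ}
    (hG : Measurable[M.unseenSigma j] G) (hG2 : MemLp G 2 μ) :
    ∫ ω, M.heldValue ω j t * G ω ∂μ = 0 := by
  have hint : Integrable (fun ω => M.heldValue ω j t * G ω) μ :=
    (M.memLp_heldValue j t).integrable_mul hG2
  have hm : ∀ n, MeasurableSet {ω | M.count j t ω = n} := fun n =>
    (M.replacements_clock j).timesSigma_le _ (M.measurableSet_count_eq j t n)
  have hU : (⋃ n, {ω | M.count j t ω = n}) = Set.univ := by ext ω; simp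
  rw [← setIntegral_univ, ← hU]
  refine setIntegral_iUnion_eq_zero hint hm ?_ fun n => ?_
  · intro m n hmn
    exact Set.disjoint_left.2 fun ω h1 h2 => hmn (h1.symm.trans h2)
  · rw [← integral_indicator (hm n)]
    rw [← M.integral_attributed_mul j n (H := {ω | M.count j t ω = n}.indicator G)
      ((hG.mono (M.unseenSigma_le_exceptSigma j n) le_rfl).indicator
        (M.replacements_le_exceptSigma j j n _ (M.measurableSet_count_eq j t n)))]
    refine integral_congr_ae (Filter.Eventually.of_forall fun ω => ?_)
    by_cases h : M.count j t ω = n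
    · simp [Set.indicator, h, heldValue]
    · simp [Set.indicator, h]

/-- The best prediction of the value at label `j` that is based on information up to time `s` is
proportional to the value held at time `s`. -/
theorem integral_heldValue_mul_of_stoppedSigma (hlamR : 0 ≤ lamR) (j : Fin N) {s t : ℝ}
    (hs : 0 ≤ s) (hst : s ≤ t) {G : Ω → ℝ}
    (hG : Measurable[M.stoppedSigma j s] G) (hG2 : MemLp G 2 μ) :
    ∫ ω, M.heldValue ω j t * G ω ∂μ =
      Real.exp (-lamR * (t - s)) * ∫ ω, M.heldValue ω j s * G ω ∂μ := by
  have hint : ∀ r, Integrable (fun ω => M.heldValue ω j r * G ω) μ := fun r =>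
    (M.memLp_heldValue j r).integrable_mul hG2
  have hle := (M.replacements_clock j).timesSigma_le
  let A : Set Ω := {ω | (M.replacements j ω ∩ Set.Ioc s t).ncard = 0}
  have hAD : MeasurableSet[MeasurableSpace.comap
      (fun ω => (M.replacements j ω ∩ Set.Ioc s t).ncard) ⊤] A := ⟨{0}, trivial, rfl⟩
  have hA : MeasurableSet A :=
    hle _ (measurable_ncard_timesSigma _ measurableSet_Ioc (MeasurableSet.singleton 0))
  have hcount : ∀ ω, M.count j t ω = M.count j s ω + (M.replacements j ω ∩ Set.Ioc s t).ncard :=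
    fun ω => (M.replacements_clock j).count_add ω hst
  rw [← integral_add_compl hA (hint t)]
  -- Without replacement in `(s, t]` the value is unchanged, and the absence of replacements is
  -- independent of `beforeSigma`; its probability is the exponential factor.
  have h1 : ∫ ω in A, M.heldValue ω j t * G ω ∂μ =
      Real.exp (-lamR * (t - s)) * ∫ ω, M.heldValue ω j s * G ω ∂μ := by
    have hmeas : Measurable[M.stoppedSigma j s] fun ω => M.heldValue ω j s * G ω :=
      (M.measurable_heldValue_stoppedSigma j s).mul hG
    have hind : IndepFun (A.indicator fun _ => (1 : ℝ)) (fun ω => M.heldValue ω j s * G ω) μ := by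
      rw [IndepFun_iff_Indep]
      refine indep_of_indep_of_le_left (indep_of_indep_of_le_right
        (M.indep_beforeSigma j hs hst) ?_) ?_
      · exact (hmeas.mono (M.stoppedSigma_le_beforeSigma j s) le_rfl).comap_le
      · exact (measurable_const.indicator hAD).comap_le
    have h2 := hind.integral_fun_mul_eq_mul_integral
      (measurable_const.indicator hA).aestronglyMeasurable (hint s).aestronglyMeasurable
    rw [integral_indicator_const _ hA, smul_eq_mul, mul_one,
      (M.replacements_clock j).measure_no_point hlamR hs hst] at h2
    rw [← h2, ← integral_indicator hA]
    refine integral_congr_ae (Filter.Eventually.of_forall fun ω => ?_)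
    by_cases h : ω ∈ A
    · have h0 : (M.replacements j ω ∩ Set.Ioc s t).ncard = 0 := h
      have : M.count j t ω = M.count j s ω := by rw [hcount, h0, add_zero]
      simp only [Set.indicator_of_mem h, one_mul, heldValue, this]
    · simp [h]
  -- After a replacement the occupant has rank `q.1 + q.2 + 1`, beyond the count `q.1` at time `s`;
  -- its value is centred and independent of everything else in the integrand.
  have h2 : ∫ ω in Aᶜ, M.heldValue ω j t * G ω ∂μ = 0 := by
    let S : ℕ × ℕ → Set Ω := fun q =>
      {ω | M.count j s ω = q.1} ∩ {ω | M.count j t ω = q.1 + q.2 + 1}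
    have hS : ∀ q, MeasurableSet (S q) := fun q =>
      (hle _ (M.measurableSet_count_eq j s _)).inter (hle _ (M.measurableSet_count_eq j t _))
    have hU : Aᶜ = ⋃ q, S q := by
      ext ω
      have := hcount ω
      simp only [A, S, Set.mem_compl_iff, Set.mem_ofPred_eq, Set.mem_iUnion, Set.mem_inter_iff,
        Prod.exists]
      constructor
      · intro h
        exact ⟨M.count j s ω, (M.replacements j ω ∩ Set.Ioc s t).ncard - 1, rfl, by omega⟩
      · rintro ⟨a, b, h1, h2⟩
        omega
    rw [hU]
    refine setIntegral_iUnion_eq_zero (hint t) hS ?_ fun q => ?_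
    · intro p q hpq
      refine Set.disjoint_left.2 fun ω h1 h2 => hpq ?_
      have h3 : M.count j s ω = p.1 := h1.1
      have h4 : M.count j s ω = q.1 := h2.1
      have h5 : M.count j t ω = p.1 + p.2 + 1 := h1.2
      have h6 : M.count j t ω = q.1 + q.2 + 1 := h2.2
      ext <;> omega
    · have hmn : q.1 < q.1 + q.2 + 1 := by omega
      rw [← integral_indicator (hS q), ← M.integral_attributed_mul j (q.1 + q.2 + 1)
        ((M.measurable_indicator_exceptSigma hG hmn).indicator
          (M.replacements_le_exceptSigma j j _ _ (M.measurableSet_count_eq j t (q.1 + q.2 + 1))))]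
      refine integral_congr_ae (Filter.Eventually.of_forall fun ω => ?_)
      by_cases h : M.count j t ω = q.1 + q.2 + 1 <;> by_cases h' : M.count j s ω = q.1 <;>
        simp [Set.indicator, h, h', heldValue, S]
  rw [h1, h2, add_zero]

end PingModel

/-! ### Measurability of an estimate for the reduced information -/

theorem IsMeasurableClock.empty {Ω : Type*} [MeasurableSpace Ω] :
    IsMeasurableClock (fun _ : Ω => (∅ : Set ℝ)) where
  pos _ := Set.empty_subset _
  locallyFinite _ _ := by simp
  measurable_count _ := by simp

/-- On `E` the knowledge set may be computed from surrogate clocks and values. If these are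
measurable for a small sigma-algebra, so is the estimate restricted to `E`. -/
theorem Algorithm.measurable_indicator_estimate {Ω : Type*} {m : MeasurableSpace Ω} {N : ℕ}
    (y : Algorithm N) {R P : Fin N → Ω → Set ℝ} {x : Ω → Fin N → ℝ → ℝ}
    (hR : ∀ j, IsMeasurableClock (R j)) (hP : ∀ j, IsMeasurableClock (P j))
    (hx : ∀ j, Measurable fun p : Ω × ℝ => x p.1 j p.2) (i : Fin N) (t : ℝ) {E : Set Ω}
    (hE : MeasurableSet E) {K : Ω → Set (Info N)}
    (hK : ∀ ω ∈ E, ∀ a, a ∈ K ω ↔ PingKnows (fun j => R j ω) (fun j => P j ω) (x ω) i t a) :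
    Measurable (E.indicator fun ω => y.estimate i t (K ω)) := by
  have h := ((y.measurable_estimate i t).comp (measurable_pingKnows hR hP hx i t)).indicator hE
  convert h using 1
  refine Set.indicator_congr fun ω hω => ?_
  simp only [Function.comp]
  congr 1
  ext a
  exact hK ω hω a

namespace PingModel

variable {Ω : Type*} {m0 : MeasurableSpace Ω} {μ : Measure Ω} {N : ℕ} {lamR lamP σ : ℝ}
variable (M : PingModel μ N lamR lamP σ)

theorem measurable_heldValue_prod_unseenSigma {j l : Fin N} (h : l ≠ j) :
    @Measurable _ _ (@Prod.instMeasurableSpace Ω ℝ (M.unseenSigma j) _) _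
      fun p : Ω × ℝ => M.heldValue p.1 l p.2 :=
  @IsMeasurableClock.measurable_value_prod Ω (M.unseenSigma j) (M.replacements l)
    (isMeasurableClock_of_timesSigma_le (M.replacements_clock l).pos
      (M.replacements_clock l).locallyFinite (M.replacements_le_unseenSigma h))
    (M.attributed l) (fun _ => M.measurable_attributed_unseenSigma h)

/-- As long as agent `i` has no ping in `(s, t]`, its estimate at time `t` does not depend on what
happens at another label `j` after time `s`. -/
theorem measurable_indicator_estimate_stoppedSigma (y : Algorithm N) {i j : Fin N} (hij : i ≠ j)
    {s t : ℝ} {E : Set Ω} (hE : MeasurableSet[M.pingSigma] E)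
    (hno : ∀ ω ∈ E, ∀ r ∈ M.pings i ω, r ≤ t → r ≤ s) :
    Measurable[M.stoppedSigma j s]
      (E.indicator fun ω => y.estimate i t (M.knowledge i t ω)) := by
  have hunseen := M.unseenSigma_le_stoppedSigma j s
  have hping : M.pingSigma ≤ M.stoppedSigma j s :=
    (le_sup_right : M.pingSigma ≤ M.unseenSigma j).trans hunseen
  have hTj : @IsMeasurableClock Ω (M.stoppedSigma j s)
      (fun ω => M.replacements j ω ∩ Set.Iic s) := by
    refine @IsMeasurableClock.mk Ω (M.stoppedSigma j s) _ ?_ ?_ ?_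
    · exact fun ω => Set.inter_subset_left.trans ((M.replacements_clock j).pos ω)
    · exact fun ω r => ((M.replacements_clock j).locallyFinite ω s).subset Set.inter_subset_left
    · intro r
      simp only [Set.inter_assoc, Set.Iic_inter_Iic]
      exact (measurable_count_pastSigma _ (min_le_left s r)).mono
        (M.pastSigma_le_stoppedSigma j s) le_rfl
  -- The surrogate system stops the clock of `j` at time `s` and truncates its ranks accordingly; it
  -- agrees with the true one up to `s` and at all other labels.
  let R' : Fin N → Ω → Set ℝ := fun l ω =>
    if l = j then M.replacements j ω ∩ Set.Iic s else M.replacements l ω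
  let x' : Ω → Fin N → ℝ → ℝ := fun ω l r =>
    if l = j then M.attributed j (min (M.replacements j ω ∩ Set.Iic s ∩ Set.Iic r).ncard
      (M.count j s ω)) ω else M.heldValue ω l r
  have hx : ∀ ω l r, r ≤ s → M.heldValue ω l r = x' ω l r := by
    intro ω l r hr
    by_cases hl : l = j
    · subst hl
      have h1 : min (M.count l r ω) (M.count l s ω) = M.count l r ω :=
        min_eq_left (M.count_mono l ω hr)
      simp only [x', if_true, Set.inter_assoc, Set.Iic_inter_Iic, min_eq_right hr, h1, heldValue]
    · simp only [x', if_neg hl]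
  have hRpos : ∀ ω l, R' l ω ⊆ Set.Ioi 0 := by
    intro ω l
    by_cases hl : l = j
    · simp only [R', if_pos hl]
      exact Set.inter_subset_left.trans ((M.replacements_clock j).pos ω)
    · simp only [R', if_neg hl]
      exact (M.replacements_clock l).pos ω
  refine @Algorithm.measurable_indicator_estimate Ω (M.stoppedSigma j s) N y R' M.pings x'
    ?_ ?_ ?_ i t E (hping _ hE) _ ?_
  · intro l
    by_cases hl : l = j
    · simp only [R', if_pos hl]
      exact hTj
    · simp only [R', if_neg hl]
      exact isMeasurableClock_of_timesSigma_le (M.replacements_clock l).pos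
        (M.replacements_clock l).locallyFinite ((M.replacements_le_unseenSigma hl).trans hunseen)
  · exact fun l => isMeasurableClock_of_timesSigma_le (M.pings_clock l).pos
      (M.pings_clock l).locallyFinite ((M.timesSigma_le_pingSigma l).trans hping)
  · intro l
    by_cases hl : l = j
    · simp only [x', if_pos hl]
      exact @IsMeasurableClock.measurable_value_prod Ω (M.stoppedSigma j s) _ hTj
        (fun k ω => M.attributed j (min k (M.count j s ω)) ω)
        (fun k => M.measurable_stopped_attributed j s k)
    · simp only [x', if_neg hl]
      exact (M.measurable_heldValue_prod_unseenSigma hl).mono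
        (sup_le_sup_right (MeasurableSpace.comap_mono hunseen) _) le_rfl
  · intro ω hω a
    constructor
    · refine fun h => PingKnows.congr_of_no_ping (s := s)
        (fun l => (M.replacements_clock l).pos ω) (fun l => (M.pings_clock l).pos ω) ?_
        (fun l r hr _ => hr) (fun l r _ hr => hx ω l r hr) ?_ ?_ (hno ω hω) h
      · intro l r hr hrs
        by_cases hl : l = j
        · subst hl
          simp only [R', if_true]
          exact ⟨hr, hrs⟩
        · simpa only [R', if_neg hl] using hr
      · intro r hr _
        simpa only [R', if_neg hij] using hr
      · intro r _ _
        simp only [x', if_neg hij]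
    · refine fun h => PingKnows.congr_of_no_ping (s := s) (hRpos ω)
        (fun l => (M.pings_clock l).pos ω) ?_ (fun l r hr _ => hr)
        (fun l r _ hr => (hx ω l r hr).symm) ?_ ?_ (hno ω hω) h
      · intro l r hr hrs
        by_cases hl : l = j
        · subst hl
          simp only [R', if_true] at hr
          exact hr.1
        · simpa only [R', if_neg hl] using hr
      · intro r hr _
        simpa only [R', if_neg hij] using hr
      · intro r _ _
        simp only [x', if_neg hij]

/-- As long as agent `i` has no ping up to time `t`, its estimate at time `t` does not depend on
what happens at another label `j`. -/
theorem measurable_indicator_estimate_unseenSigma (y : Algorithm N) {i j : Fin N} (hij : i ≠ j)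
    {t : ℝ} {E : Set Ω} (hE : MeasurableSet[M.pingSigma] E)
    (hno : ∀ ω ∈ E, ∀ r ∈ M.pings i ω, ¬ r ≤ t) :
    Measurable[M.unseenSigma j]
      (E.indicator fun ω => y.estimate i t (M.knowledge i t ω)) := by
  have hping : M.pingSigma ≤ M.unseenSigma j := le_sup_right
  -- The surrogate system has no replacements and only zero values at label `j`.
  let R' : Fin N → Ω → Set ℝ := fun l ω => if l = j then ∅ else M.replacements l ω
  let x' : Ω → Fin N → ℝ → ℝ := fun ω l r => if l = j then 0 else M.heldValue ω l r
  have hRpos : ∀ ω l, R' l ω ⊆ Set.Ioi 0 := by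
    intro ω l
    by_cases hl : l = j
    · simp only [R', if_pos hl, Set.empty_subset]
    · simp only [R', if_neg hl]
      exact (M.replacements_clock l).pos ω
  refine @Algorithm.measurable_indicator_estimate Ω (M.unseenSigma j) N y R' M.pings x'
    ?_ ?_ ?_ i t E (hping _ hE) _ ?_
  · intro l
    by_cases hl : l = j
    · simp only [R', if_pos hl]
      exact @IsMeasurableClock.empty Ω (M.unseenSigma j)
    · simp only [R', if_neg hl]
      exact isMeasurableClock_of_timesSigma_le (M.replacements_clock l).pos
        (M.replacements_clock l).locallyFinite (M.replacements_le_unseenSigma hl)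
  · exact fun l => isMeasurableClock_of_timesSigma_le (M.pings_clock l).pos
      (M.pings_clock l).locallyFinite ((M.timesSigma_le_pingSigma l).trans hping)
  · intro l
    by_cases hl : l = j
    · simp only [x', if_pos hl]
      exact measurable_const
    · simp only [x', if_neg hl]
      exact M.measurable_heldValue_prod_unseenSigma hl
  · intro ω hω a
    constructor
    -- All times are nonnegative, so `s = -1` makes every requirement on the past vacuous.
    · refine fun h => PingKnows.congr_of_no_ping (s := -1)
        (fun l => (M.replacements_clock l).pos ω) (fun l => (M.pings_clock l).pos ω)
        (fun l r hr h1 => absurd ((M.replacements_clock l).pos ω hr) (h1.trans neg_one_lt_zero.le).not_gt)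
        (fun l r hr _ => hr) (fun l r h0 h1 => by linarith) ?_ ?_
        (fun r hr hrt => absurd hrt (hno ω hω r hr)) h
      · intro r hr _
        simpa only [R', if_neg hij] using hr
      · intro r _ _
        simp only [x', if_neg hij]
    · refine fun h => PingKnows.congr_of_no_ping (s := -1) (hRpos ω)
        (fun l => (M.pings_clock l).pos ω)
        (fun l r hr h1 => absurd (hRpos ω l hr) (h1.trans neg_one_lt_zero.le).not_gt)
        (fun l r hr _ => hr) (fun l r h0 h1 => by linarith) ?_ ?_
        (fun r hr hrt => absurd hrt (hno ω hω r hr)) h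
      · intro r hr _
        simpa only [R', if_neg hij] using hr
      · intro r _ _
        simp only [x', if_neg hij]

end PingModel

/-! ### Error on an event: a lower bound by orthogonality -/

theorem MeasureTheory.MemLp.integrable_fun_mul {Ω : Type*} {m : MeasurableSpace Ω} {μ : Measure Ω}
    {f g : Ω → ℝ} (hf : MemLp f 2 μ) (hg : MemLp g 2 μ) : Integrable (fun ω => f ω * g ω) μ :=
  hf.integrable_mul hg

/-- A lower bound on the second moment of a variable in terms of its covariances with an orthogonal
family. -/
theorem integral_sq_ge_of_orthogonal {Ω ι : Type*} {m : MeasurableSpace Ω} {μ : Measure Ω}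
    (J : Finset ι) {V : Ω → ℝ} {Z : ι → Ω → ℝ} (hV : MemLp V 2 μ) (hZ : ∀ j ∈ J, MemLp (Z j) 2 μ)
    {a b : ℝ} (ha : ∀ j ∈ J, ∫ ω, Z j ω * V ω ∂μ = a) (hb : ∀ j ∈ J, ∫ ω, Z j ω * Z j ω ∂μ = b)
    (h0 : ∀ j ∈ J, ∀ k ∈ J, j ≠ k → ∫ ω, Z j ω * Z k ω ∂μ = 0) (w : ℝ) :
    J.card * (2 * w * a - w ^ 2 * b) ≤ ∫ ω, V ω ^ 2 ∂μ := by
  have hW : MemLp (fun ω => ∑ j ∈ J, Z j ω) 2 μ := memLp_finsetSum J hZ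
  have h1 : ∫ ω, (∑ j ∈ J, Z j ω) * V ω ∂μ = J.card * a := by
    simp only [Finset.sum_mul]
    rw [integral_finsetSum J fun j hj => (hZ j hj).integrable_fun_mul hV, Finset.sum_congr rfl ha]
    simp
  have h2 : ∀ j ∈ J, ∫ ω, Z j ω * ∑ k ∈ J, Z k ω ∂μ = b := by
    intro j hj
    simp only [Finset.mul_sum]
    rw [integral_finsetSum J fun k hk => (hZ j hj).integrable_fun_mul (hZ k hk),
      Finset.sum_eq_single j (fun k hk hkj => h0 j hj k hk hkj.symm) (fun h => absurd hj h),
      hb j hj]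
  have h3 : ∫ ω, (∑ j ∈ J, Z j ω) * ∑ k ∈ J, Z k ω ∂μ = J.card * b := by
    simp only [Finset.sum_mul]
    rw [integral_finsetSum J fun j hj => (hZ j hj).integrable_fun_mul hW, Finset.sum_congr rfl h2]
    simp
  -- The bound is the expansion of this square; the best choice of `w` is `a / b`.
  have h4 : 0 ≤ ∫ ω, (V ω - w * ∑ j ∈ J, Z j ω) ^ 2 ∂μ :=
    integral_nonneg fun ω => sq_nonneg _
  have h5 : ∀ ω, (V ω - w * ∑ j ∈ J, Z j ω) ^ 2 = V ω ^ 2 -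
      (2 * w) * ((∑ j ∈ J, Z j ω) * V ω) + w ^ 2 * ((∑ j ∈ J, Z j ω) * ∑ j ∈ J, Z j ω) :=
    fun ω => by ring
  have i1 : Integrable (fun ω => (2 * w) * ((∑ j ∈ J, Z j ω) * V ω)) μ :=
    (hW.integrable_fun_mul hV).const_mul _
  have i2 : Integrable (fun ω => w ^ 2 * ((∑ j ∈ J, Z j ω) * ∑ j ∈ J, Z j ω)) μ :=
    (hW.integrable_fun_mul hW).const_mul _
  have i0 : Integrable (fun ω => V ω ^ 2 - (2 * w) * ((∑ j ∈ J, Z j ω) * V ω)) μ :=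
    hV.integrable_sq.sub i1
  simp only [h5] at h4
  rw [integral_add i0 i2, integral_sub hV.integrable_sq i1,
    integral_const_mul, integral_const_mul, h1, h3] at h4
  linarith

namespace PingModel

variable {Ω : Type*} {m0 : MeasurableSpace Ω} {μ : Measure Ω} {N : ℕ}
  {lamR lamP σ : ℝ} (M : PingModel μ N lamR lamP σ)

theorem measurable_average (t : ℝ) : Measurable (M.average t) :=
  (Finset.measurable_sum _ fun i _ => M.measurable_heldValue i t).const_mul _

variable [IsProbabilityMeasure μ]

theorem memLp_average (t : ℝ) : MemLp (M.average t) 2 μ :=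
  (memLp_finsetSum _ fun i _ => M.memLp_heldValue i t).const_mul _

/-- If the information that is used on the event `E` predicts the value at each label `j ≠ i` by
`B j` at best, then the error on `E` is at least the one of the best predictions. -/
theorem le_setLIntegral_of_best_predictions (i : Fin N) {t : ℝ} {E : Set Ω}
    (hE : MeasurableSet[M.pingSigma] E) {Y : Ω → ℝ} (G : Fin N → MeasurableSpace Ω)
    (B : Fin N → Ω → ℝ) {p : ℝ} (hG : ∀ j, M.unseenSigma j ≤ G j) (hG' : ∀ j, G j ≤ m0)
    (hY : ∀ j, i ≠ j → Measurable[G j] (E.indicator Y))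
    (hB : ∀ j, Measurable[G j] (B j)) (hB' : ∀ j k, k ≠ j → Measurable[M.unseenSigma j] (B k))
    (hBL : ∀ j, MemLp (B j) 2 μ) (hB2 : ∀ j, ∫ ω in E, B j ω ^ 2 ∂μ = μ.real E * (p ^ 2 * σ ^ 2))
    (horth : ∀ j g, Measurable[G j] g → MemLp g 2 μ →
      ∫ ω, M.heldValue ω j t * g ω ∂μ = ∫ ω, B j ω * g ω ∂μ) :
    ENNReal.ofReal (((N : ℝ) - 1) / (N : ℝ) ^ 2 * (μ.real E * (1 - p ^ 2)) * σ ^ 2) ≤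
      ∫⁻ ω in E, ENNReal.ofReal ((M.average t ω - Y ω) ^ 2) ∂μ := by
  have hN : (N : ℝ) ≠ 0 := by have := i.pos; positivity
  -- With a single label the factor `N - 1` vanishes. Otherwise some `j₀ ≠ i` provides the
  -- measurability of the estimate on `E`.
  rcases (Finset.univ.erase i).eq_empty_or_nonempty with hJ | ⟨j₀, hj₀⟩
  · have h1 : (Finset.univ.erase i).card = 0 := by rw [hJ]; rfl
    rw [Finset.card_erase_of_mem (Finset.mem_univ i), Finset.card_univ, Fintype.card_fin] at h1
    have h2 : N = 1 := by have := i.pos; omega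
    simp [h2]
  have hE0 : MeasurableSet E := M.pingSigma_le _ hE
  have hEG : ∀ j, MeasurableSet[G j] E := fun j =>
    ((le_sup_right : M.pingSigma ≤ M.unseenSigma j).trans (hG j)) _ hE
  have hYm : Measurable (E.indicator Y) :=
    (hY j₀ (Finset.ne_of_mem_erase hj₀).symm).mono (hG' j₀) le_rfl
  let V : Ω → ℝ := fun ω => E.indicator (M.average t) ω - E.indicator Y ω
  have hVm : Measurable V := ((M.measurable_average t).indicator hE0).sub hYm
  have hVE : ∀ ω, V ω = E.indicator (fun ω => M.average t ω - Y ω) ω := fun ω => by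
    by_cases h : ω ∈ E <;> simp [V, h]
  have hlint : ∫⁻ ω in E, ENNReal.ofReal ((M.average t ω - Y ω) ^ 2) ∂μ =
      ∫⁻ ω, ENNReal.ofReal (V ω ^ 2) ∂μ := by
    rw [← lintegral_indicator hE0]
    refine lintegral_congr fun ω => ?_
    rw [hVE]
    by_cases h : ω ∈ E <;> simp [h]
  rw [hlint]
  -- Nothing is assumed on the integrability of the estimate: an infinite error is harmless, and a
  -- finite one makes the estimate square integrable on `E`.
  by_cases htop : ∫⁻ ω, ENNReal.ofReal (V ω ^ 2) ∂μ = ⊤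
  · rw [htop]; exact le_top
  have hVint : Integrable (fun ω => V ω ^ 2) μ := by
    refine ⟨(hVm.pow_const 2).aestronglyMeasurable, ?_⟩
    rw [hasFiniteIntegral_iff_ofReal (Filter.Eventually.of_forall fun ω => sq_nonneg _)]
    exact lt_top_iff_ne_top.2 htop
  have hV : MemLp V 2 μ := (memLp_two_iff_integrable_sq hVm.aestronglyMeasurable).2 hVint
  have hYL : MemLp (E.indicator Y) 2 μ := by
    have : E.indicator Y = fun ω => E.indicator (M.average t) ω - V ω := by
      funext ω; simp [V]
    rw [this]
    exact ((M.memLp_average t).indicator hE0).sub hV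
  rw [← ofReal_integral_eq_lintegral_ofReal hVint
    (Filter.Eventually.of_forall fun ω => sq_nonneg _)]
  refine ENNReal.ofReal_le_ofReal ?_
  set c : ℝ := μ.real E * ((1 - p ^ 2) * σ ^ 2) with hc
  have hx := fun j => M.memLp_heldValue j t
  have hxB : ∀ j, MemLp (fun ω => M.heldValue ω j t - B j ω) 2 μ := fun j => (hx j).sub (hBL j)
  have horth' : ∀ j g, Measurable[G j] g → MemLp g 2 μ →
      ∫ ω, (M.heldValue ω j t - B j ω) * g ω ∂μ = 0 := by
    intro j g hg hgL
    simp only [sub_mul]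
    rw [integral_sub ((hx j).integrable_fun_mul hgL) ((hBL j).integrable_fun_mul hgL),
      horth j g hg hgL, sub_self]
  have hind : ∀ f g : Ω → ℝ, ∫ ω, f ω * E.indicator g ω ∂μ = ∫ ω in E, f ω * g ω ∂μ := by
    intro f g
    rw [← integral_indicator hE0]
    refine integral_congr_ae (Filter.Eventually.of_forall fun ω => ?_)
    by_cases h : ω ∈ E <;> simp [h]
  -- Testing `horth` against `B j` on `E` replaces the cross term by the second moment of `B j`,
  -- which leaves `σ ^ 2 - p ^ 2 * σ ^ 2`.
  have hown : ∀ j, ∫ ω, (M.heldValue ω j t - B j ω) *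
      E.indicator (fun ω => M.heldValue ω j t) ω ∂μ = c := by
    intro j
    have h1 : ∫ ω, M.heldValue ω j t * E.indicator (fun ω => M.heldValue ω j t) ω ∂μ =
        μ.real E * σ ^ 2 := by
      rw [hind, ← M.setIntegral_heldValue_sq j t hE]
      simp only [sq]
    have h2 : ∫ ω, B j ω * E.indicator (fun ω => M.heldValue ω j t) ω ∂μ =
        μ.real E * (p ^ 2 * σ ^ 2) := by
      rw [hind, ← hB2 j]
      have := horth j (E.indicator (B j)) ((hB j).indicator (hEG j)) ((hBL j).indicator hE0)
      rw [hind, hind] at this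
      simp only [mul_comm (B j _) (M.heldValue _ _ _), this, sq]
    simp only [sub_mul]
    rw [integral_sub ((hx j).integrable_fun_mul ((hx j).indicator hE0))
      ((hBL j).integrable_fun_mul ((hx j).indicator hE0)), h1, h2, hc]
    ring
  let Z : Fin N → Ω → ℝ := fun j => E.indicator fun ω => M.heldValue ω j t - B j ω
  have hZmul : ∀ j (g : Ω → ℝ), ∫ ω, Z j ω * g ω ∂μ =
      ∫ ω, (M.heldValue ω j t - B j ω) * E.indicator g ω ∂μ := by
    intro j g
    refine integral_congr_ae (Filter.Eventually.of_forall fun ω => ?_)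
    by_cases h : ω ∈ E <;> simp [Z, h]
  have hZL : ∀ j, MemLp (Z j) 2 μ := fun j => (hxB j).indicator hE0
  have hZV : ∀ j ∈ Finset.univ.erase i, ∫ ω, Z j ω * V ω ∂μ = c / N := by
    intro j hj
    have hij : i ≠ j := (Finset.ne_of_mem_erase hj).symm
    -- Once `x_j / N` is removed, the error involves only the other labels and the estimate, so it
    -- is `G j`-measurable and orthogonal to the prediction error at `j`.
    let g : Ω → ℝ := fun ω => E.indicator (fun ω => (1 / (N : ℝ)) *
      ∑ l ∈ Finset.univ.erase j, M.heldValue ω l t) ω - E.indicator Y ω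
    have hg : Measurable[G j] g := by
      refine Measurable.sub (Measurable.indicator ?_ (hEG j)) (hY j hij)
      refine Measurable.const_mul ?_ _
      exact Finset.measurable_fun_sum _ fun l hl =>
        (M.measurable_heldValue_unseenSigma (Finset.ne_of_mem_erase hl) t).mono (hG j) le_rfl
    have hgL : MemLp g 2 μ :=
      (((memLp_finsetSum _ fun l _ => hx l).const_mul _).indicator hE0).sub hYL
    have hsplit : ∀ ω, (M.heldValue ω j t - B j ω) * E.indicator V ω =
        (1 / (N : ℝ)) * ((M.heldValue ω j t - B j ω) *
          E.indicator (fun ω => M.heldValue ω j t) ω) +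
        (M.heldValue ω j t - B j ω) * g ω := by
      intro ω
      by_cases h : ω ∈ E
      · simp only [Set.indicator_of_mem h, V, g, average,
          ← Finset.add_sum_erase _ _ (Finset.mem_univ j)]
        ring
      · simp [h, g]
    rw [hZmul]
    simp only [hsplit]
    rw [integral_add (((hxB j).integrable_fun_mul ((hx j).indicator hE0)).const_mul _)
      ((hxB j).integrable_fun_mul hgL), integral_const_mul, hown, horth' j g hg hgL]
    ring
  have hZZ : ∀ j ∈ Finset.univ.erase i, ∫ ω, Z j ω * Z j ω ∂μ = c := by
    intro j _
    have hsplit : ∀ ω, (M.heldValue ω j t - B j ω) * E.indicator (Z j) ω =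
        (M.heldValue ω j t - B j ω) * E.indicator (fun ω => M.heldValue ω j t) ω -
        (M.heldValue ω j t - B j ω) * E.indicator (B j) ω := by
      intro ω
      by_cases h : ω ∈ E
      · simp only [Set.indicator_of_mem h, Z]
        ring
      · simp [h]
    rw [hZmul]
    simp only [hsplit]
    rw [integral_sub ((hxB j).integrable_fun_mul ((hx j).indicator hE0))
      ((hxB j).integrable_fun_mul ((hBL j).indicator hE0)), hown,
      horth' j _ ((hB j).indicator (hEG j)) ((hBL j).indicator hE0), sub_zero]
  have hZ0 : ∀ j ∈ Finset.univ.erase i, ∀ k ∈ Finset.univ.erase i, j ≠ k →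
      ∫ ω, Z j ω * Z k ω ∂μ = 0 := by
    intro j _ k _ hjk
    rw [hZmul]
    refine horth' j _ ((Measurable.indicator ?_ (hEG j)).indicator (hEG j))
      ((hZL k).indicator hE0)
    exact ((M.measurable_heldValue_unseenSigma hjk.symm t).sub (hB' j k hjk.symm)).mono (hG j) le_rfl
  -- Here `a = c / N` and `b = c`, so `w = 1 / N` is optimal and each of the `N - 1` labels
  -- contributes `c / N ^ 2`.
  have key := integral_sq_ge_of_orthogonal (Finset.univ.erase i) hV (fun j _ => hZL j) hZV hZZ hZ0
    (1 / (N : ℝ))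
  refine le_trans (le_of_eq ?_) key
  rw [Finset.card_erase_of_mem (Finset.mem_univ i), Finset.card_univ, Fintype.card_fin,
    Nat.cast_sub i.pos, hc]
  field_simp
  push_cast
  ring

end PingModel

/-! ### Averaging over the time of the last ping -/

theorem sum_setLIntegral_sdiff_add {Ω : Type*} {m : MeasurableSpace Ω} {μ : Measure Ω}
    (f : Ω → ENNReal) {B : ℕ → Set Ω} (hB : ∀ k, MeasurableSet (B k)) (n : ℕ)
    (hanti : ∀ k < n, B (k + 1) ⊆ B k) :
    ∑ k ∈ Finset.range n, ∫⁻ ω in B k \ B (k + 1), f ω ∂μ + ∫⁻ ω in B n, f ω ∂μ =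
      ∫⁻ ω in B 0, f ω ∂μ := by
  induction n with
  | zero => simp
  | succ n ih =>
    rw [← ih fun k hk => hanti k (by omega), Finset.sum_range_succ, add_assoc,
      add_comm (∫⁻ ω in B n \ _, f ω ∂μ),
      ← lintegral_inter_add_sdiff f (B n) (hB (n + 1)),
      Set.inter_eq_self_of_subset_right (hanti n (by omega))]

/-- The lower integral is superadditive without measurability, and only this direction is needed to
add up the errors of the agents. -/
theorem sum_lintegral_le_lintegral_sum {Ω ι : Type*} {m : MeasurableSpace Ω} {μ : Measure Ω}
    (s : Finset ι) (f : ι → Ω → ENNReal) :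
    ∑ i ∈ s, ∫⁻ ω, f i ω ∂μ ≤ ∫⁻ ω, ∑ i ∈ s, f i ω ∂μ := by
  classical
  induction s using Finset.induction_on with
  | empty => simp
  | insert a s ha ih =>
    simp only [Finset.sum_insert ha]
    exact (add_le_add le_rfl ih).trans (le_lintegral_add _ _)

/-- A geometric Riemann sum is bounded below by the integral up to an error of the order of the
mesh. -/
theorem geometric_riemann_sum_ge {a b h : ℝ} (ha : 0 < a) (hb : 0 ≤ b) (n : ℕ) :
    1 - a / (a + b) * (1 + (a + b) * h) * (1 - Real.exp (-(a + b) * (n * h))) ≤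
      ∑ k ∈ Finset.range n, (Real.exp (-a * (k * h)) - Real.exp (-a * ((k + 1 : ℕ) * h))) *
        (1 - Real.exp (-b * (k * h))) + Real.exp (-a * (n * h)) := by
  set q := Real.exp (-a * h) with hq
  set Q := Real.exp (-(a + b) * h) with hQ
  have hc : 0 < a + b := by linarith
  have hpow : ∀ (c : ℝ) (k : ℕ), Real.exp (-c * (k * h)) = Real.exp (-c * h) ^ k := fun c k => by
    rw [← Real.exp_nat_mul]; ring_nf
  have hQk : ∀ k : ℕ, q ^ k * Real.exp (-b * h) ^ k = Q ^ k := fun k => by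
    rw [← mul_pow, hq, hQ, ← Real.exp_add]; ring_nf
  have hterm : ∀ k : ℕ, (Real.exp (-a * (k * h)) - Real.exp (-a * ((k + 1 : ℕ) * h))) *
      (1 - Real.exp (-b * (k * h))) = (q ^ k - q ^ (k + 1)) - (1 - q) * Q ^ k := fun k => by
    rw [hpow, hpow, hpow, ← hQk k, ← hq]; ring
  simp only [hterm, hpow a n, hpow (a + b) n, ← hq, ← hQ]
  rw [Finset.sum_sub_distrib, Finset.sum_range_sub', ← Finset.mul_sum]
  have h1 : 1 - q ≤ a * h := by have := Real.add_one_le_exp (-a * h); linarith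
  -- Equivalent to `(1 + (a + b) * h) * Q ≤ 1`. With `h1` it bounds `(1 - q) / (1 - Q)` without
  -- dividing, since `1 - Q` vanishes for `h = 0`.
  have h2 : (a + b) * h ≤ (1 + (a + b) * h) * (1 - Q) := by
    have h3 := Real.add_one_le_exp ((a + b) * h)
    have h4 : Real.exp ((a + b) * h) * Q = 1 := by
      rw [hQ, ← Real.exp_add, neg_mul, add_neg_cancel, Real.exp_zero]
    have h5 : 0 < Q := Real.exp_pos _
    nlinarith
  have h3 : 1 - q ≤ a / (a + b) * ((1 + (a + b) * h) * (1 - Q)) := by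
    refine h1.trans ?_
    rw [div_mul_eq_mul_div, le_div_iff₀ hc]
    nlinarith
  have h4 : 0 ≤ ∑ k ∈ Finset.range n, Q ^ k := Finset.sum_nonneg fun k _ => by positivity
  have h5 : (1 - Q) * ∑ k ∈ Finset.range n, Q ^ k = 1 - Q ^ n := mul_neg_geom_sum Q n
  have h6 := mul_le_mul_of_nonneg_right h3 h4
  have h7 : a / (a + b) * ((1 + (a + b) * h) * (1 - Q)) * ∑ k ∈ Finset.range n, Q ^ k =
      a / (a + b) * (1 + (a + b) * h) * (1 - Q ^ n) := by rw [← h5]; ring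
  rw [h7] at h6
  simp only [pow_zero]
  linarith

namespace PingModel

variable {Ω : Type*} {m0 : MeasurableSpace Ω} {μ : Measure Ω} {N : ℕ}
  {lamR lamP σ : ℝ} (M : PingModel μ N lamR lamP σ)

/-- The event that agent `i` has no ping in `(s, t]`. -/
def noPing (i : Fin N) (s t : ℝ) : Set Ω := {ω | (M.pings i ω ∩ Set.Ioc s t).ncard = 0}

theorem mem_noPing (i : Fin N) (s t : ℝ) (ω : Ω) :
    ω ∈ M.noPing i s t ↔ ∀ r ∈ M.pings i ω, r ≤ t → r ≤ s := by
  have hfin : (M.pings i ω ∩ Set.Ioc s t).Finite := ((M.pings_clock i).locallyFinite ω t).subset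
    (Set.inter_subset_inter_right _ Set.Ioc_subset_Iic_self)
  rw [noPing, Set.mem_ofPred_eq, Set.ncard_eq_zero hfin, Set.eq_empty_iff_forall_notMem]
  constructor
  · exact fun h r hr hrt => not_lt.1 fun hsr => h r ⟨hr, hsr, hrt⟩
  · rintro h r ⟨hr, hsr, hrt⟩
    exact not_lt.2 (h r hr hrt) hsr

theorem measurableSet_noPing (i : Fin N) (s t : ℝ) : MeasurableSet[M.pingSigma] (M.noPing i s t) :=
  M.timesSigma_le_pingSigma i _
    (measurable_ncard_timesSigma _ measurableSet_Ioc (MeasurableSet.singleton 0))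

variable [IsProbabilityMeasure μ]

/-- Nothing about other labels has reached `i`, so each foreign value is best predicted by its mean
`0`. -/
theorem le_setLIntegral_of_no_ping (y : Algorithm N) (i : Fin N) {t : ℝ}
    {E : Set Ω} (hE : MeasurableSet[M.pingSigma] E)
    (hno : ∀ ω ∈ E, ∀ r ∈ M.pings i ω, ¬ r ≤ t) :
    ENNReal.ofReal (((N : ℝ) - 1) / (N : ℝ) ^ 2 * μ.real E * σ ^ 2) ≤
      ∫⁻ ω in E, ENNReal.ofReal ((M.average t ω - y.estimate i t (M.knowledge i t ω)) ^ 2) ∂μ := by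
  have := M.le_setLIntegral_of_best_predictions i (t := t) hE
    (Y := fun ω => y.estimate i t (M.knowledge i t ω)) (fun j => M.unseenSigma j)
    (fun _ _ => 0) (p := 0) (fun j => le_rfl)
    (fun j => (M.unseenSigma_le_exceptSigma j 0).trans (M.exceptSigma_le j 0))
    (fun j hij => M.measurable_indicator_estimate_unseenSigma y hij hE hno)
    (fun j => measurable_const) (fun j k _ => measurable_const) (fun j => MemLp.zero)
    (fun j => by simp)
    (fun j g hg hgL => by
      rw [M.integral_heldValue_mul_of_unseenSigma j t hg hgL]; simp)
  simpa using this

/-- The time `s` need not be a ping time: it only bounds the last ping from above, so the agent is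
credited with at least the information that it has. -/
theorem le_setLIntegral_of_last_ping (hlamR : 0 ≤ lamR) (y : Algorithm N) (i : Fin N) {s t : ℝ}
    (hs : 0 ≤ s) (hst : s ≤ t) {E : Set Ω} (hE : MeasurableSet[M.pingSigma] E)
    (hno : ∀ ω ∈ E, ∀ r ∈ M.pings i ω, r ≤ t → r ≤ s) :
    ENNReal.ofReal (((N : ℝ) - 1) / (N : ℝ) ^ 2 *
        (μ.real E * (1 - Real.exp (-lamR * (t - s)) ^ 2)) * σ ^ 2) ≤
      ∫⁻ ω in E, ENNReal.ofReal ((M.average t ω - y.estimate i t (M.knowledge i t ω)) ^ 2) ∂μ := by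
  refine M.le_setLIntegral_of_best_predictions i (t := t) hE
    (Y := fun ω => y.estimate i t (M.knowledge i t ω)) (fun j => M.stoppedSigma j s)
    (fun j ω => Real.exp (-lamR * (t - s)) * M.heldValue ω j s)
    (fun j => M.unseenSigma_le_stoppedSigma j s)
    (fun j => (M.stoppedSigma_le_beforeSigma j s).trans (M.beforeSigma_le j s))
    (fun j hij => M.measurable_indicator_estimate_stoppedSigma y hij hE hno)
    (fun j => (M.measurable_heldValue_stoppedSigma j s).const_mul _)
    (fun j k hkj => (M.measurable_heldValue_unseenSigma hkj s).const_mul _)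
    (fun j => (M.memLp_heldValue j s).const_mul _) (fun j => ?_) (fun j g hg hgL => ?_)
  · simp only [mul_pow]
    rw [integral_const_mul, M.setIntegral_heldValue_sq j s hE]
    ring
  · simp only [mul_assoc]
    rw [integral_const_mul, M.integral_heldValue_mul_of_stoppedSigma hlamR j hs hst hg hgL]

theorem le_lintegral_agent (hlamR : 0 < lamR) (hlamP : 0 < lamP) (y : Algorithm N) (i : Fin N)
    {t : ℝ} (ht : 0 ≤ t) {n : ℕ} (hn : n ≠ 0) :
    ENNReal.ofReal (((N : ℝ) - 1) / (N : ℝ) ^ 2 * (1 - lamP / (lamP + 2 * lamR) *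
        (1 + (lamP + 2 * lamR) * (t / n)) * (1 - Real.exp (-(lamP + 2 * lamR) * t))) * σ ^ 2) ≤
      ∫⁻ ω, ENNReal.ofReal ((M.average t ω - y.estimate i t (M.knowledge i t ω)) ^ 2) ∂μ := by
  set h : ℝ := t / n with hh
  have hn0 : (n : ℝ) ≠ 0 := Nat.cast_ne_zero.2 hn
  have hh0 : 0 ≤ h := by positivity
  have hnh : n * h = t := by rw [hh]; field_simp
  have hN : (1 : ℝ) ≤ N := by exact_mod_cast i.pos
  -- On `B k \ B (k + 1)` the last ping falls in `(t - (k + 1) * h, t - k * h]`. Taking `s` to be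
  -- the right end of this interval keeps the estimate a lower bound.
  let B : ℕ → Set Ω := fun k => M.noPing i (t - k * h) t
  have hB : ∀ k, MeasurableSet[M.pingSigma] (B k) := fun k => M.measurableSet_noPing i _ _
  have hB' : ∀ k, MeasurableSet (B k) := fun k => M.pingSigma_le _ (hB k)
  have hkt : ∀ k : ℕ, k ≤ n → 0 ≤ t - k * h := fun k hk => by
    have : (k : ℝ) * h ≤ n * h := mul_le_mul_of_nonneg_right (by exact_mod_cast hk) hh0
    linarith
  have hkt' : ∀ k : ℕ, t - k * h ≤ t := fun k => by
    have : 0 ≤ (k : ℝ) * h := by positivity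
    linarith
  have hanti : ∀ k, B (k + 1) ⊆ B k := by
    intro k ω hω
    rw [M.mem_noPing] at hω ⊢
    intro r hr hrt
    have := hω r hr hrt
    push_cast at this
    nlinarith
  have hBreal : ∀ k ≤ n, μ.real (B k) = Real.exp (-lamP * (k * h)) := fun k hk => by
    have := (M.pings_clock i).measure_no_point hlamP.le (hkt k hk) (hkt' k)
    rw [show t - (t - k * h) = k * h by ring] at this
    exact this
  have hB0 : B 0 = Set.univ := by
    ext ω
    simp only [B, M.mem_noPing, Set.mem_univ, iff_true]
    intro r _ hrt
    simpa using hrt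
  set f : Ω → ENNReal := fun ω =>
    ENNReal.ofReal ((M.average t ω - y.estimate i t (M.knowledge i t ω)) ^ 2) with hf
  have hsum := sum_setLIntegral_sdiff_add (μ := μ) f hB' n fun k _ => hanti k
  rw [hB0, Measure.restrict_univ] at hsum
  rw [← hsum]
  let c : ℕ → ℝ := fun k => ((N : ℝ) - 1) / (N : ℝ) ^ 2 *
    ((Real.exp (-lamP * (k * h)) - Real.exp (-lamP * ((k + 1 : ℕ) * h))) *
      (1 - Real.exp (-(2 * lamR) * (k * h)))) * σ ^ 2
  have hN1 : 0 ≤ ((N : ℝ) - 1) / (N : ℝ) ^ 2 := div_nonneg (by linarith) (by positivity)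
  have hc0 : ∀ k, 0 ≤ c k := by
    intro k
    have hkh : 0 ≤ (k : ℝ) * h := by positivity
    refine mul_nonneg (mul_nonneg hN1 (mul_nonneg (sub_nonneg.2 (Real.exp_le_exp.2 ?_))
      (sub_nonneg.2 (Real.exp_le_one_iff.2 ?_)))) (sq_nonneg σ)
    · push_cast
      nlinarith
    · nlinarith
  have hpiece : ∀ k ∈ Finset.range n, ENNReal.ofReal (c k) ≤ ∫⁻ ω in B k \ B (k + 1), f ω ∂μ := by
    intro k hk
    rw [Finset.mem_range] at hk
    have h1 := M.le_setLIntegral_of_last_ping hlamR.le y i (hkt k hk.le) (hkt' k)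
      ((hB k).diff (hB (k + 1))) fun ω hω => (M.mem_noPing i _ _ ω).1 hω.1
    rw [measureReal_sdiff (hanti k) (hB' (k + 1)), hBreal k hk.le, hBreal (k + 1) hk,
      show t - (t - k * h) = k * h by ring, ← Real.exp_nat_mul] at h1
    refine le_trans (le_of_eq ?_) h1
    simp only [c]
    congr 6
    push_cast
    ring
  have hlast : ENNReal.ofReal (((N : ℝ) - 1) / (N : ℝ) ^ 2 * Real.exp (-lamP * (n * h)) * σ ^ 2) ≤
      ∫⁻ ω in B n, f ω ∂μ := by
    -- `B n` excludes pings in `(0, t]`, hence all pings up to `t`, as clocks have only positive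
    -- times.
    have h1 := M.le_setLIntegral_of_no_ping y i (t := t) (hB n) fun ω hω r hr hrt => by
      have h2 := (M.mem_noPing i _ _ ω).1 hω r hr hrt
      rw [hnh, sub_self] at h2
      exact not_lt.2 h2 ((M.pings_clock i).pos ω hr)
    rwa [hBreal n le_rfl] at h1
  refine le_trans ?_ (add_le_add (Finset.sum_le_sum hpiece) hlast)
  rw [← ENNReal.ofReal_sum_of_nonneg fun k _ => hc0 k,
    ← ENNReal.ofReal_add (Finset.sum_nonneg fun k _ => hc0 k) (by positivity)]
  refine ENNReal.ofReal_le_ofReal ?_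
  have key := geometric_riemann_sum_ge hlamP (by positivity : 0 ≤ 2 * lamR) n (h := h)
  rw [hnh] at key
  simp only [c]
  rw [← Finset.sum_mul, ← Finset.mul_sum, ← add_mul, ← mul_add, hnh]
  gcongr

end PingModel
-- Vanishing mesh and average over the agents
theorem mainTheorem3 {Ω : Type*} [MeasurableSpace Ω] (μ : Measure Ω) [IsProbabilityMeasure μ]
    (N : ℕ) (hN : 1 ≤ N) (lamR lamP σ : ℝ) (hlamR : 0 < lamR) (hlamP : 0 < lamP)
    (M : PingModel μ N lamR lamP σ) (y : Algorithm N) (t : ℝ) (ht : 0 ≤ t) :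
    ENNReal.ofReal
        (((N : ℝ) - 1) / (N : ℝ) ^ 2 *
          (1 / (1 + (1 / 2) * (lamP / lamR)) +
            Real.exp (-(lamP + 2 * lamR) * t) / (1 + 2 * (lamR / lamP))) * σ ^ 2)
      ≤ ∫⁻ ω, ENNReal.ofReal (M.meanSquaredError y t ω) ∂μ := by
  have hN0 : (0 : ℝ) < N := by exact_mod_cast hN
  set F : ℝ := 1 / (1 + (1 / 2) * (lamP / lamR)) +
    Real.exp (-(lamP + 2 * lamR) * t) / (1 + 2 * (lamR / lamP)) with hF
  -- The factor with mesh `0` is kept so that this is literally the limit of the bounds with mesh `t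
  -- / n`.
  have hF' : F = 1 - lamP / (lamP + 2 * lamR) * (1 + (lamP + 2 * lamR) * 0) *
      (1 - Real.exp (-(lamP + 2 * lamR) * t)) := by
    rw [hF]
    generalize Real.exp (-(lamP + 2 * lamR) * t) = e
    have h1 : lamP + 2 * lamR ≠ 0 := by positivity
    have h2 : 1 + (1 / 2) * (lamP / lamR) = (lamP + 2 * lamR) / (2 * lamR) := by field_simp; ring
    have h3 : 1 + 2 * (lamR / lamP) = (lamP + 2 * lamR) / lamP := by field_simp
    rw [h2, h3]
    field_simp
    ring
  have hagent : ∀ i, ENNReal.ofReal (((N : ℝ) - 1) / (N : ℝ) ^ 2 * F * σ ^ 2) ≤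
      ∫⁻ ω, ENNReal.ofReal ((M.average t ω - y.estimate i t (M.knowledge i t ω)) ^ 2) ∂μ := by
    intro i
    have hlim : Filter.Tendsto (fun n : ℕ => ENNReal.ofReal (((N : ℝ) - 1) / (N : ℝ) ^ 2 *
        (1 - lamP / (lamP + 2 * lamR) * (1 + (lamP + 2 * lamR) * (t / n)) *
          (1 - Real.exp (-(lamP + 2 * lamR) * t))) * σ ^ 2)) Filter.atTop
        (nhds (ENNReal.ofReal (((N : ℝ) - 1) / (N : ℝ) ^ 2 * F * σ ^ 2))) := by
      rw [hF']
      refine ENNReal.tendsto_ofReal (((tendsto_const_nhds.sub (((tendsto_const_nhds.add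
        ((tendsto_const_div_atTop_nhds_zero_nat t).const_mul _)).const_mul _).mul_const
          _)).const_mul _).mul_const _)
    refine le_of_tendsto hlim ?_
    filter_upwards [Filter.eventually_ne_atTop 0] with n hn
    exact M.le_lintegral_agent hlamR hlamP y i ht hn
  have hC : ∀ ω, ENNReal.ofReal (M.meanSquaredError y t ω) = ENNReal.ofReal (1 / N) *
      ∑ i, ENNReal.ofReal ((M.average t ω - y.estimate i t (M.knowledge i t ω)) ^ 2) := by
    intro ω
    rw [PingModel.meanSquaredError, ENNReal.ofReal_mul (by positivity),
      ENNReal.ofReal_sum_of_nonneg fun i _ => sq_nonneg _]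
  simp only [hC]
  rw [lintegral_const_mul' _ _ ENNReal.ofReal_ne_top]
  refine le_trans ?_ (mul_le_mul_right ((Finset.sum_le_sum fun i _ => hagent i).trans
    (sum_lintegral_le_lintegral_sum _ _)) _)
  rw [Finset.sum_const, Finset.card_univ, Fintype.card_fin, nsmul_eq_mul, ← mul_assoc,
    ← ENNReal.ofReal_natCast, ← ENNReal.ofReal_mul (by positivity),
    one_div_mul_cancel hN0.ne', ENNReal.ofReal_one, one_mul]
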